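/- Let $E=(E^0,E^1,r,s)$ be an arbitrary directed graph (no countability or finiteness assumption), let $K$ be a field, and let $H\subseteq E^0$ be a nonempty set of vertices. **Conventions.** A path $e_1\cdots e_n$ satisfies $r(e_i)=s(e_{i+1})$; vertices are the paths of length $0$; $E^*$ is the set of finite paths, $E^\infty$ the set of infinite paths, and $|\alpha|$ is the length of $\alpha \in E^*$. The *Leavitt path algebra* $L_K(E)$ is the (not necessarily unital) associative $K$-algebra generated by the vertices $v\in E^0$ and symbols $e,e^*$ ($e\in E^1$) subject to: $vw=\delta_{v,w}v$; $s(e)e=e=e\,r(e)$ and $r(e)e^*=e^*=e^*s(e)$; $e^*f=\delta_{e,f}r(e)$; and $v=\sum_{e\in s^{-1}(v)}ee^*$ whenever $0<|s^{-1}(v)|<\infty$. Let $X_E=E^\infty\cup\{p\in E^*: s^{-1}(r(p))\text{ is empty or infinite}\}$. The *graph groupoid* is $$\mathcal G_E=\{(\alpha x,|\alpha|-|\beta|,\beta x)\mid \alpha,\beta\in E^*,\ x\in X_E,\ r(\alpha)=s(x)=r(\beta)\},$$ where $(x,k,y)$ is a morphism with range $x$ and source $y$, $(x,k,y)(y,l,z)=(x,k+l,z)$,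 $(x,k,y)^{-1}=(y,-k,x)$, and the object $x$ is identified with $(x,0,x)$. For $\alpha,\beta\in E^*$ with $r(\alpha)=r(\beta)$ put $Z(\alpha,\beta)=\{(\alpha x,|\alpha|-|\beta|,\beta x)\mid x\in X_E,\ s(x)=r(\alpha)\}$; the topology of $\mathcal G_E$ has as a basis the sets $Z(\alpha,\beta,F)=Z(\alpha,\beta)\setminus\bigcup_{e\in F}Z(\alpha e,\beta e)$, with $F\subseteq s^{-1}(r(\alpha))$ finite. Put $$\mathcal G_E|_H=\{(\alpha x,|\alpha|-|\beta|,\beta x)\in\mathcal G_E\mid \alpha,\beta\in E^*,\ x\in X_E,\ s(\alpha),s(\beta)\in H\}.$$ A topological groupoid $\mathcal G$ is *étale* if its unit space $\mathcal G^{(0)}$ is locally compact Hausdorff and its source map $\mathcal G\to\mathcal G^{(0)}$ is a local homeomorphism; an *open bisection* is an open set on which the source and range maps are homeomorphisms onto open subsets of $\mathcal G^{(0)}$; $\mathcal G$ is *ample* if it is étale and has a base of compact open bisections. For an ample groupoid $\mathcal G$, the *Steinberg algebra* $A_K(\mathcal G)$ is the $K$-linear span of the characteristic functions $1_U:\mathcal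 G\to K$ of the compact open bisections $U$, with the convolution product $(f*g)(\gamma)=\sum_{\gamma=\alpha\beta}f(\alpha)g(\beta)$. **Theorem.** 1. $\mathcal G_E|_H$ is an open subset of $\mathcal G_E$, is closed under composition and inversion, and, with the restricted operations and the subspace topology, is an ample groupoid. 2. There is an isomorphism of $K$-algebras $\sum_{v,w\in H}vL_K(E)w\cong A_K(\mathcal G_E|_H)$, where the left-hand side is the subalgebra of $L_K(E)$ consisting of all finite sums of elements of the sets $vL_K(E)w$ with $v,w\in H$. 3. If $H$ is finite, then $\big(\sum_{v\in H}v\big)L_K(E)\big(\sum_{v\in H}v\big)\cong A_K(\mathcal G_E|_H)$ as $K$-algebras. -/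

import Mathlib

universe u v w

/-- A directed graph with vertex set `V`, edge set `E`, source map `src` and range map `rng`. -/
structure DirectedGraph (V : Type u) (E : Type v) where
  /-- the source of an edge -/
  src : E → V
  /-- the range of an edge -/
  rng : E → V

/-! ### Corners of non-unital algebras -/

section Corners

variable (K : Type w) [CommSemiring K] {A : Type u} [NonUnitalSemiring A] [Module K A]
  [IsScalarTower K A A] [SMulCommClass K A A]

/-- The corner `e A e` of a (not necessarily unital) algebra `A`. -/
def algebraCorner (e : A) : NonUnitalSubalgebra K A where
  carrier := {y | ∃ a : A, y = e * a * e}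
  add_mem' := by
    rintro _ _ ⟨a, rfl⟩ ⟨b, rfl⟩
    exact ⟨a + b, by rw [mul_add, add_mul]⟩
  zero_mem' := ⟨0, by rw [mul_zero, zero_mul]⟩
  mul_mem' := by
    rintro _ _ ⟨a, rfl⟩ ⟨b, rfl⟩
    exact ⟨a * e * e * b, by simp only [mul_assoc]⟩
  smul_mem' := by
    rintro k _ ⟨a, rfl⟩
    exact ⟨k • a, by rw [mul_smul_comm, smul_mul_assoc]⟩

/-- The corner-like subalgebra `∑_{f, f' ∈ F} f A f'` of an algebra `A`: the span of all elements
`f a f'` with `f, f' ∈ F` and `a ∈ A`, i.e. the set of finite sums of such elements. -/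
def cornerLike (F : Set A) : NonUnitalSubalgebra K A where
  toNonUnitalSubsemiring :=
    { (Submodule.span K {y : A | ∃ f ∈ F, ∃ f' ∈ F, ∃ a : A, y = f * a * f'}).toAddSubmonoid with
      mul_mem' := by
        intro x y hx hy
        change x ∈ Submodule.span K _ at hx
        change y ∈ Submodule.span K _ at hy
        change x * y ∈ Submodule.span K _
        induction hx, hy using Submodule.span_induction₂ with
        | mem_mem x y hx hy =>
          obtain ⟨f, hf, f', hf', a, rfl⟩ := hx
          obtain ⟨g, hg, g', hg', b, rfl⟩ := hy
          exact Submodule.subset_span ⟨f, hf, g', hg', a * f' * g * b, by simp only [mul_assoc]⟩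
        | zero_left y hy => rw [zero_mul]; exact Submodule.zero_mem _
        | zero_right x hx => rw [mul_zero]; exact Submodule.zero_mem _
        | add_left x y z _ _ _ h₁ h₂ => rw [add_mul]; exact Submodule.add_mem _ h₁ h₂
        | add_right x y z _ _ _ h₁ h₂ => rw [mul_add]; exact Submodule.add_mem _ h₁ h₂
        | smul_left r x y _ _ h => rw [smul_mul_assoc]; exact Submodule.smul_mem _ _ h
        | smul_right r x y _ _ h => rw [mul_smul_comm]; exact Submodule.smul_mem _ _ h }
  smul_mem' := fun k _ hx => Submodule.smul_mem _ k hx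

end Corners

/-! ### Leavitt path algebras -/

namespace DirectedGraph

section Leavitt

variable {V : Type u} {E : Type v} (Γ : DirectedGraph V E) (K : Type w) [Field K]

/-- The generators of the Leavitt path algebra: the vertices, the edges `e` and the
ghost edges `e*`. -/
inductive LeavittGen (V : Type u) (E : Type v) : Type (max u v)
  | vertex (v : V)
  | edge (e : E)
  | ghost (e : E)

/-- The free (associative, non-unital) `K`-algebra on the vertices, edges and ghost edges. -/
abbrev LeavittFree (V : Type u) (E : Type v) (K : Type w) [Field K] : Type (max u v w) :=
  MonoidAlgebra K (FreeSemigroup (LeavittGen V E))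

/-- A generator as an element of the free algebra. -/
noncomputable def freeGen (x : LeavittGen V E) : LeavittFree V E K :=
  MonoidAlgebra.single (FreeSemigroup.of x) 1

open LeavittGen in
/-- The defining relations of the Leavitt path algebra. -/
inductive LeavittRel : LeavittFree V E K → LeavittFree V E K → Prop
  | vertex_mul_self (v : V) :
      LeavittRel (freeGen K (vertex v) * freeGen K (vertex v)) (freeGen K (vertex v))
  | vertex_mul_ne (v w : V) (h : v ≠ w) :
      LeavittRel (freeGen K (vertex v) * freeGen K (vertex w)) 0
  | src_mul_edge (e : E) :
      LeavittRel (freeGen K (vertex (Γ.src e)) * freeGen K (edge e)) (freeGen K (edge e))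
  | edge_mul_rng (e : E) :
      LeavittRel (freeGen K (edge e) * freeGen K (vertex (Γ.rng e))) (freeGen K (edge e))
  | rng_mul_ghost (e : E) :
      LeavittRel (freeGen K (vertex (Γ.rng e)) * freeGen K (ghost e)) (freeGen K (ghost e))
  | ghost_mul_src (e : E) :
      LeavittRel (freeGen K (ghost e) * freeGen K (vertex (Γ.src e))) (freeGen K (ghost e))
  | ghost_mul_self (e : E) :
      LeavittRel (freeGen K (ghost e) * freeGen K (edge e)) (freeGen K (vertex (Γ.rng e)))
  | ghost_mul_ne (e f : E) (h : e ≠ f) :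
      LeavittRel (freeGen K (ghost e) * freeGen K (edge f)) 0
  | regular (v : V) (hne : {e | Γ.src e = v}.Nonempty) (hfin : {e | Γ.src e = v}.Finite) :
      LeavittRel (freeGen K (vertex v))
        (∑ e ∈ hfin.toFinset, freeGen K (edge e) * freeGen K (ghost e))

/-- The least congruence of `K`-algebras on the free algebra that contains the relations. -/
noncomputable def leavittCon : RingCon (LeavittFree V E K) :=
  sInf {c | (∀ x y, Γ.LeavittRel K x y → c x y) ∧ ∀ (k : K) (x y), c x y → c (k • x) (k • y)}

/-- The Leavitt path algebra `L_K(Γ)`: the (non-unital) `K`-algebra presented by the vertices,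
edges and ghost edges subject to the relations above. -/
def LeavittPathAlgebra : Type (max u v w) := (Γ.leavittCon K).Quotient

noncomputable instance : NonUnitalRing (Γ.LeavittPathAlgebra K) :=
  inferInstanceAs (NonUnitalRing (Γ.leavittCon K).Quotient)

variable {K} in
theorem leavittCon_smul (k : K) {x y : LeavittFree V E K} (h : Γ.leavittCon K x y) :
    Γ.leavittCon K (k • x) (k • y) :=
  fun c hc => hc.2 k x y (h c hc)

noncomputable instance : SMul K (Γ.LeavittPathAlgebra K) where
  smul k := Quotient.map (fun x => k • x) fun _ _ h => Γ.leavittCon_smul k h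

/-- The class of an element of the free algebra in the Leavitt path algebra. -/
noncomputable def leavittMk (x : LeavittFree V E K) : Γ.LeavittPathAlgebra K :=
  RingCon.toQuotient (c := Γ.leavittCon K) x

theorem leavittMk_surjective : Function.Surjective (Γ.leavittMk K) := Quotient.exists_rep

noncomputable instance : Module K (Γ.LeavittPathAlgebra K) where
  one_smul x := by
    obtain ⟨x, rfl⟩ := Γ.leavittMk_surjective K x
    exact congrArg (Γ.leavittMk K) (one_smul K x)
  mul_smul a b x := by
    obtain ⟨x, rfl⟩ := Γ.leavittMk_surjective K x
    exact congrArg (Γ.leavittMk K) (mul_smul a b x)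
  smul_zero a := congrArg (Γ.leavittMk K) (smul_zero a)
  smul_add a x y := by
    obtain ⟨x, rfl⟩ := Γ.leavittMk_surjective K x
    obtain ⟨y, rfl⟩ := Γ.leavittMk_surjective K y
    exact congrArg (Γ.leavittMk K) (smul_add a x y)
  add_smul a b x := by
    obtain ⟨x, rfl⟩ := Γ.leavittMk_surjective K x
    exact congrArg (Γ.leavittMk K) (add_smul a b x)
  zero_smul x := by
    obtain ⟨x, rfl⟩ := Γ.leavittMk_surjective K x
    exact congrArg (Γ.leavittMk K) (zero_smul K x)

instance : IsScalarTower K (Γ.LeavittPathAlgebra K) (Γ.LeavittPathAlgebra K) where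
  smul_assoc a x y := by
    obtain ⟨x, rfl⟩ := Γ.leavittMk_surjective K x
    obtain ⟨y, rfl⟩ := Γ.leavittMk_surjective K y
    exact congrArg (Γ.leavittMk K) (smul_mul_assoc a x y)

instance : SMulCommClass K (Γ.LeavittPathAlgebra K) (Γ.LeavittPathAlgebra K) where
  smul_comm a x y := by
    obtain ⟨x, rfl⟩ := Γ.leavittMk_surjective K x
    obtain ⟨y, rfl⟩ := Γ.leavittMk_surjective K y
    exact congrArg (Γ.leavittMk K) (mul_smul_comm a x y).symm

/-- The vertex `v` as an element of the Leavitt path algebra. -/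
noncomputable def leavittVertex (v : V) : Γ.LeavittPathAlgebra K :=
  Γ.leavittMk K (freeGen K (.vertex v))

end Leavitt

end DirectedGraph

/-! ### Paths, the boundary path space and the graph groupoid -/

namespace DirectedGraph

section Paths

variable {V : Type u} {E : Type v} (Γ : DirectedGraph V E)

/-- The list of edges `l` is (the sequence of edges of) a path starting at `v`. -/
def IsWalk : V → List E → Prop
  | _, [] => True
  | v, e :: l => Γ.src e = v ∧ IsWalk (Γ.rng e) l

/-- The vertex at which a path with start `v` and edges `l` ends. -/
def walkEnd : V → List E → V
  | v, [] => v
  | _, e :: l => walkEnd (Γ.rng e) l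

theorem isWalk_append {v : V} {l m : List E} :
    Γ.IsWalk v (l ++ m) ↔ Γ.IsWalk v l ∧ Γ.IsWalk (Γ.walkEnd v l) m := by
  induction l generalizing v with
  | nil => simp [IsWalk, walkEnd]
  | cons e l ih => simp [IsWalk, walkEnd, ih, and_assoc]

theorem walkEnd_append {v : V} {l m : List E} :
    Γ.walkEnd v (l ++ m) = Γ.walkEnd (Γ.walkEnd v l) m := by
  induction l generalizing v with
  | nil => rfl
  | cons e l ih => exact ih

/-- A finite path; a path of length `0` is a vertex. -/
@[ext]
structure FinPath where
  /-- the source of the path -/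
  start : V
  /-- the edges of the path, in order -/
  edges : List E
  isWalk : Γ.IsWalk start edges

/-- An infinite path. -/
@[ext]
structure InfPath where
  /-- the edges of the path, in order -/
  edges : Stream' E
  chain : ∀ n, Γ.rng (edges.get n) = Γ.src (edges.get (n + 1))

/-- A finite or infinite path. -/
inductive Path
  | fin (p : Γ.FinPath)
  | inf (p : Γ.InfPath)

variable {Γ}

/-- The range `r(α)` of a finite path. -/
def FinPath.finish (α : Γ.FinPath) : V := Γ.walkEnd α.start α.edges

/-- The length `|α|` of a finite path. -/
def FinPath.length (α : Γ.FinPath) : ℕ := α.edges.length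

/-- The source of a finite or infinite path. -/
def Path.start : Γ.Path → V
  | .fin p => p.start
  | .inf p => Γ.src (p.edges.get 0)

variable (Γ) in
/-- A vertex as a path of length `0`. -/
def FinPath.vertex (v : V) : Γ.FinPath := ⟨v, [], trivial⟩

variable (Γ) in
/-- An edge as a path of length `1`. -/
def FinPath.edge (e : E) : Γ.FinPath := ⟨Γ.src e, [e], rfl, trivial⟩

/-- The concatenation `αβ` of finite paths. -/
def FinPath.append (α β : Γ.FinPath) (h : α.finish = β.start) : Γ.FinPath where
  start := α.start
  edges := α.edges ++ β.edges
  isWalk := Γ.isWalk_append.2 ⟨α.isWalk, by have := β.isWalk; rwa [← h] at this⟩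

theorem FinPath.finish_append (α β : Γ.FinPath) (h : α.finish = β.start) :
    (α.append β h).finish = β.finish := by
  simp only [FinPath.finish, FinPath.append] at h ⊢
  rw [walkEnd_append, h]

theorem src_append_stream {v : V} {l : List E} (hl : Γ.IsWalk v l) {s : Stream' E}
    (h : Γ.walkEnd v l = Γ.src (s.get 0)) : Γ.src ((l ++ₛ s).get 0) = v := by
  cases l with
  | nil => exact h.symm
  | cons e l => exact hl.1

theorem chain_append_stream {v : V} {l : List E} (hl : Γ.IsWalk v l) {s : Stream' E}
    (hs : ∀ n, Γ.rng (s.get n) = Γ.src (s.get (n + 1))) (h : Γ.walkEnd v l = Γ.src (s.get 0)) :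
    ∀ n, Γ.rng ((l ++ₛ s).get n) = Γ.src ((l ++ₛ s).get (n + 1)) := by
  induction l generalizing v with
  | nil => exact hs
  | cons e l ih =>
    intro n
    cases n with
    | zero => exact (src_append_stream hl.2 h).symm
    | succ n => exact ih hl.2 h n

/-- The concatenation `αx` of a finite path and an infinite path. -/
def FinPath.appendInf (α : Γ.FinPath) (x : Γ.InfPath) (h : α.finish = Γ.src (x.edges.get 0)) :
    Γ.InfPath where
  edges := α.edges ++ₛ x.edges
  chain := chain_append_stream α.isWalk x.chain h

/-- The concatenation `αx` of a finite path and a finite or infinite path. -/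
def FinPath.concat (α : Γ.FinPath) : (x : Γ.Path) → (h : α.finish = x.start) → Γ.Path
  | .fin x, h => .fin (α.append x h)
  | .inf x, h => .inf (α.appendInf x h)

theorem FinPath.start_concat (α : Γ.FinPath) (x : Γ.Path) (h : α.finish = x.start) :
    (α.concat x h).start = α.start := by
  cases x with
  | fin x => rfl
  | inf x => exact src_append_stream α.isWalk h

theorem FinPath.vertex_concat (x : Γ.Path) (v : V) (h : (FinPath.vertex Γ v).finish = x.start) :
    (FinPath.vertex Γ v).concat x h = x := by
  cases x with
  | fin x => exact congrArg Path.fin (FinPath.ext h rfl)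
  | inf x => exact congrArg Path.inf (InfPath.ext rfl)

theorem FinPath.append_concat (α μ : Γ.FinPath) (y : Γ.Path) (h : α.finish = μ.start)
    (h' : μ.finish = y.start) (h₁ : (α.append μ h).finish = y.start)
    (h₂ : α.finish = (μ.concat y h').start) :
    (α.append μ h).concat y h₁ = α.concat (μ.concat y h') h₂ := by
  cases y with
  | fin y => exact congrArg Path.fin (FinPath.ext rfl (List.append_assoc _ _ _))
  | inf y => exact congrArg Path.inf (InfPath.ext (Stream'.append_append_stream _ _ _))

theorem stream_factor {l m : List E} {s t : Stream' E} (h : l ++ₛ s = m ++ₛ t)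
    (hlen : l.length ≤ m.length) : ∃ k, m = l ++ k ∧ s = k ++ₛ t := by
  induction l generalizing m with
  | nil => exact ⟨m, rfl, h⟩
  | cons a l ih =>
    cases m with
    | nil => simp at hlen
    | cons b m =>
      have h0 : a = b := congrArg Stream'.head h
      have h1 : l ++ₛ s = m ++ₛ t := congrArg Stream'.tail h
      obtain ⟨k, rfl, hs⟩ := ih h1 (by simpa using hlen)
      exact ⟨k, by rw [h0]; rfl, hs⟩

theorem FinPath.factor {β γ : Γ.FinPath} {x y : Γ.Path} (hβ : β.finish = x.start)
    (hγ : γ.finish = y.start) (h : β.concat x hβ = γ.concat y hγ) (hlen : β.length ≤ γ.length) :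
    ∃ (μ : Γ.FinPath) (hμ : β.finish = μ.start) (hy : μ.finish = y.start),
      γ = β.append μ hμ ∧ x = μ.concat y hy := by
  have hs : β.start = γ.start := by
    rw [← FinPath.start_concat β x hβ, h, FinPath.start_concat]
  have key : ∀ k, γ.edges = β.edges ++ k → ∃ (μ : Γ.FinPath) (hμ : β.finish = μ.start)
      (_ : μ.finish = y.start), γ = β.append μ hμ ∧ μ.edges = k := by
    intro k hk
    have hw : Γ.IsWalk β.start (β.edges ++ k) := by rw [← hk, hs]; exact γ.isWalk
    refine ⟨⟨β.finish, k, (Γ.isWalk_append.1 hw).2⟩, rfl, ?_, FinPath.ext hs.symm hk, rfl⟩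
    rw [← hγ]
    simp only [FinPath.finish]
    rw [hk, ← hs, walkEnd_append]
  cases x with
  | fin x =>
    cases y with
    | inf y => simp [FinPath.concat] at h
    | fin y =>
      have he : β.edges ++ x.edges = γ.edges ++ y.edges :=
        congrArg FinPath.edges (Path.fin.inj h)
      obtain ⟨k, hk, hx⟩ : ∃ k, γ.edges = β.edges ++ k ∧ x.edges = k ++ y.edges := by
        rcases List.append_eq_append_iff.1 he with ⟨k, h1, h2⟩ | ⟨k, h1, h2⟩
        · exact ⟨k, h1, h2⟩
        · have : k = [] := by
            have := congrArg List.length h1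
            rw [List.length_append] at this
            simp only [FinPath.length] at hlen
            exact List.eq_nil_of_length_eq_zero (by omega)
          subst this
          exact ⟨[], by simpa using h1.symm, by simpa using h2.symm⟩
      obtain ⟨μ, hμ, hy, h1, rfl⟩ := key k hk
      exact ⟨μ, hμ, hy, h1, congrArg Path.fin (FinPath.ext (hβ.symm.trans hμ) hx)⟩
  | inf x =>
    cases y with
    | fin y => simp [FinPath.concat] at h
    | inf y =>
      have he : β.edges ++ₛ x.edges = γ.edges ++ₛ y.edges :=
        congrArg InfPath.edges (Path.inf.inj h)
      obtain ⟨k, hk, hx⟩ := stream_factor he hlen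
      obtain ⟨μ, hμ, hy, h1, rfl⟩ := key k hk
      exact ⟨μ, hμ, hy, h1, congrArg Path.inf (InfPath.ext hx)⟩

variable (Γ)

/-- A path lies in `X_Γ` iff it is infinite or ends in a sink or an infinite emitter. -/
def IsBoundary : Γ.Path → Prop
  | .fin p => {e | Γ.src e = p.finish} = ∅ ∨ {e | Γ.src e = p.finish}.Infinite
  | .inf _ => True

/-- The space `X_Γ`. -/
def BoundaryPath : Type (max u v) := {x : Γ.Path // Γ.IsBoundary x}

variable {Γ} in
/-- The triple `(a, k, b)` is `(αx, |α| - |β|, βx)`. -/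
def IsTriple (α β : Γ.FinPath) (x a : Γ.BoundaryPath) (k : ℤ) (b : Γ.BoundaryPath) : Prop :=
  ∃ (hα : α.finish = x.1.start) (hβ : β.finish = x.1.start),
    a.1 = α.concat x.1 hα ∧ k = (α.length : ℤ) - (β.length : ℤ) ∧ b.1 = β.concat x.1 hβ

/-- The graph groupoid: the set of all triples `(αx, |α| - |β|, βx)` with `α`, `β` finite paths
and `x ∈ X_Γ` such that `r(α) = s(x) = r(β)`. -/
@[ext]
structure GraphGroupoid where
  /-- the range of the morphism -/
  target : Γ.BoundaryPath
  /-- the degree of the morphism -/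
  deg : ℤ
  /-- the source of the morphism -/
  source : Γ.BoundaryPath
  exists_triple : ∃ α β x, IsTriple α β x target deg source

variable {Γ}

theorem IsTriple.comp {α β γ δ : Γ.FinPath} {x y a b c : Γ.BoundaryPath} {k l : ℤ}
    (h : IsTriple α β x a k b) (h' : IsTriple γ δ y b l c) :
    ∃ α' β' z, IsTriple α' β' z a (k + l) c := by
  obtain ⟨hα, hβ, ha, hk, hb⟩ := h
  obtain ⟨hγ, hδ, hb', hl, hc⟩ := h'
  have hbb := hb.symm.trans hb'
  rcases le_total β.length γ.length with hle | hle
  · obtain ⟨μ, hμ, hy, rfl, hx⟩ := FinPath.factor hβ hγ hbb hle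
    have hαμ : α.finish = μ.start := by rw [hα, ← hβ, hμ]
    have hf : (α.append μ hαμ).finish = y.1.start := by rw [FinPath.finish_append, hy]
    refine ⟨α.append μ hαμ, δ, y, hf, hδ, ?_, ?_, hc⟩
    · rw [ha, FinPath.append_concat α μ y.1 hαμ hy hf (by rw [FinPath.start_concat, hαμ])]
      congr 1
    · rw [hk, hl]
      simp only [FinPath.length, FinPath.append, List.length_append]
      push_cast
      ring
  · obtain ⟨μ, hμ, hx', rfl, hy⟩ := FinPath.factor hγ hβ hbb.symm hle
    have hδμ : δ.finish = μ.start := by rw [hδ, ← hγ, hμ]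
    have hf : (δ.append μ hδμ).finish = x.1.start := by rw [FinPath.finish_append, hx']
    refine ⟨α, δ.append μ hδμ, x, hα, hf, ha, ?_, ?_⟩
    · rw [hk, hl]
      simp only [FinPath.length, FinPath.append, List.length_append]
      push_cast
      ring
    · rw [hc, FinPath.append_concat δ μ x.1 hδμ hx' hf (by rw [FinPath.start_concat, hδμ])]
      congr 1

theorem IsTriple.symm {α β : Γ.FinPath} {x a b : Γ.BoundaryPath} {k : ℤ}
    (h : IsTriple α β x a k b) : IsTriple β α x b (-k) a := by
  obtain ⟨hα, hβ, ha, hk, hb⟩ := h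
  exact ⟨hβ, hα, hb, by rw [hk]; ring, ha⟩

theorem isTriple_refl (a : Γ.BoundaryPath) :
    IsTriple (FinPath.vertex Γ a.1.start) (FinPath.vertex Γ a.1.start) a a 0 a :=
  ⟨rfl, rfl, (FinPath.vertex_concat _ _ _).symm, by simp, (FinPath.vertex_concat _ _ _).symm⟩

/-- The set `Z(α, β)`. -/
def cylinder (α β : Γ.FinPath) : Set Γ.GraphGroupoid :=
  {g | ∃ x, IsTriple α β x g.target g.deg g.source}

/-- The set `Z(α, β, F) = Z(α, β) \ ⋃_{e ∈ F} Z(αe, βe)`, for `F` a finite set of edges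
emitted by the vertex `r(α) = r(β)`. -/
def cylinderDiff (α β : Γ.FinPath) (h : α.finish = β.finish) (F : Finset E)
    (hF : ∀ e ∈ F, Γ.src e = α.finish) : Set Γ.GraphGroupoid :=
  cylinder α β \ ⋃ (e : E) (he : e ∈ F),
    cylinder (α.append (FinPath.edge Γ e) (hF e he).symm)
      (β.append (FinPath.edge Γ e) (h.symm.trans (hF e he).symm))

/-- The topology on the graph groupoid generated by the sets `Z(α, β, F)` (which form a basis). -/
instance : TopologicalSpace Γ.GraphGroupoid :=
  TopologicalSpace.generateFrom
    {S | ∃ (α β : Γ.FinPath) (h : α.finish = β.finish) (F : Finset E)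
      (hF : ∀ e ∈ F, Γ.src e = α.finish), S = cylinderDiff α β h F hF}

end Paths

end DirectedGraph

/-! ### Topological groupoids -/

/-- A groupoid, viewed as a set of arrows `G` with a partial composition: `comp a b` is defined
when the source of `a` is the range of `b`. Objects are identified with the identity arrows,
so that the source and range maps take values in `G`. -/
class ArrowGroupoid (G : Type u) where
  /-- the source (identity arrow) of an arrow -/
  src : G → G
  /-- the range (identity arrow) of an arrow -/
  rng : G → G
  /-- the inverse of an arrow -/
  inv : G → G
  /-- the composite of two composable arrows -/
  comp : (a b : G) → src a = rng b → G
  src_src : ∀ a, src (src a) = src a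
  rng_src : ∀ a, rng (src a) = src a
  src_rng : ∀ a, src (rng a) = rng a
  rng_rng : ∀ a, rng (rng a) = rng a
  src_comp : ∀ a b h, src (comp a b h) = src b
  rng_comp : ∀ a b h, rng (comp a b h) = rng a
  comp_assoc : ∀ a b c hab hbc h₁ h₂, comp (comp a b hab) c h₁ = comp a (comp b c hbc) h₂
  comp_src : ∀ a h, comp a (src a) h = a
  rng_comp_self : ∀ a h, comp (rng a) a h = a
  src_inv : ∀ a, src (inv a) = rng a
  rng_inv : ∀ a, rng (inv a) = src a
  inv_comp : ∀ a h, comp (inv a) a h = src a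
  comp_inv : ∀ a h, comp a (inv a) h = rng a

namespace ArrowGroupoid

/-- The unit space `G⁽⁰⁾`, the set of identity arrows. -/
def unitSpace (G : Type u) [ArrowGroupoid G] : Set G := Set.range src

section Basic

variable {G : Type u} [ArrowGroupoid G]

/-- The source map `G → G⁽⁰⁾`. -/
def srcUnit (g : G) : unitSpace G := ⟨src g, g, rfl⟩

/-- The range map `G → G⁽⁰⁾`. -/
def rngUnit (g : G) : unitSpace G := ⟨rng g, rng g, src_rng g⟩

theorem srcUnit_eq {a b : G} : srcUnit a = srcUnit b ↔ src a = src b := Subtype.ext_iff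

theorem rngUnit_eq {a b : G} : rngUnit a = rngUnit b ↔ rng a = rng b := Subtype.ext_iff

theorem rngUnit_eq_comp : (rngUnit : G → unitSpace G) = srcUnit ∘ inv :=
  funext fun a => Subtype.ext (src_inv a).symm

theorem inv_comp_comp (a b : G) (hab : src a = rng b) (h : src (inv a) = rng (comp a b hab)) :
    comp (inv a) (comp a b hab) h = b := by
  rw [← comp_assoc (inv a) a b (src_inv a) hab (by rw [src_comp, hab])]
  simp only [inv_comp, hab, rng_comp_self]

theorem comp_inv_comp (a c : G) (h1 : src (inv a) = rng c)
    (h : src a = rng (comp (inv a) c h1)) : comp a (comp (inv a) c h1) h = c := by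
  rw [← comp_assoc a (inv a) c (rng_inv a).symm h1 (by rw [src_comp, h1])]
  simp only [comp_inv, (src_inv a).symm.trans h1, rng_comp_self]

theorem inv_inv (a : G) : inv (inv a) = a := by
  have h : src (inv (inv a)) = rng (comp (inv a) a (src_inv a)) := by
    rw [rng_comp, src_inv]
  refine Eq.trans ?_ (inv_comp_comp (inv a) a (src_inv a) h)
  have h3 : src (inv (inv a)) = src a := by rw [src_inv, rng_inv]
  have h4 : ∀ x (h : src (inv (inv a)) = rng x), x = src (inv (inv a)) →
      comp (inv (inv a)) x h = inv (inv a) := by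
    rintro _ h rfl
    exact comp_src _ _
  exact (h4 _ h ((inv_comp a (src_inv a)).trans h3.symm)).symm

theorem comp_left_cancel {a b c : G} (hb : src a = rng b) (hc : src a = rng c)
    (h : comp a b hb = comp a c hc) : b = c := by
  rw [← inv_comp_comp a b hb (by rw [rng_comp, src_inv])]
  simp only [h, inv_comp_comp]

/-- The product `U V` of two subsets of a groupoid. -/
def setMul (U V : Set G) : Set G := {γ | ∃ α ∈ U, ∃ β ∈ V, ∃ h, comp α β h = γ}

theorem setMul_assoc (U V W : Set G) : setMul (setMul U V) W = setMul U (setMul V W) := by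
  ext γ
  constructor
  · rintro ⟨_, ⟨α, hα, β, hβ, h, rfl⟩, δ, hδ, h', rfl⟩
    have h₁ : src β = rng δ := by rw [← h', src_comp]
    have h₂ : src α = rng (comp β δ h₁) := by rw [rng_comp, h]
    exact ⟨α, hα, _, ⟨β, hβ, δ, hδ, h₁, rfl⟩, h₂, (comp_assoc α β δ h h₁ h' h₂).symm⟩
  · rintro ⟨α, hα, _, ⟨β, hβ, δ, hδ, h, rfl⟩, h', rfl⟩
    have h₁ : src α = rng β := by rw [h', rng_comp]
    have h₂ : src (comp α β h₁) = rng δ := by rw [src_comp, h]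
    exact ⟨_, ⟨α, hα, β, hβ, h₁, rfl⟩, δ, hδ, h₂, comp_assoc α β δ h₁ h h₂ h'⟩

end Basic

/-- A subgroupoid: a set of arrows that is closed under inversion and composition. -/
structure Subgroupoid (G : Type u) [ArrowGroupoid G] where
  /-- the underlying set of arrows -/
  carrier : Set G
  inv_mem : ∀ a ∈ carrier, inv a ∈ carrier
  comp_mem : ∀ a ∈ carrier, ∀ b ∈ carrier, ∀ h, comp a b h ∈ carrier

section Sub

variable {G : Type u} [ArrowGroupoid G] (S : Subgroupoid G)

theorem Subgroupoid.src_mem (a : G) (ha : a ∈ S.carrier) : src a ∈ S.carrier := by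
  rw [← inv_comp a (src_inv a)]
  exact S.comp_mem _ (S.inv_mem a ha) a ha _

theorem Subgroupoid.rng_mem (a : G) (ha : a ∈ S.carrier) : rng a ∈ S.carrier := by
  rw [← comp_inv a (rng_inv a).symm]
  exact S.comp_mem a ha _ (S.inv_mem a ha) _

/-- A subgroupoid is a groupoid, with the restricted operations. -/
instance Subgroupoid.instArrowGroupoid : ArrowGroupoid S.carrier where
  src a := ⟨src a.1, S.src_mem a.1 a.2⟩
  rng a := ⟨rng a.1, S.rng_mem a.1 a.2⟩
  inv a := ⟨inv a.1, S.inv_mem a.1 a.2⟩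
  comp a b h := ⟨comp a.1 b.1 (congrArg Subtype.val h), S.comp_mem a.1 a.2 b.1 b.2 _⟩
  src_src a := Subtype.ext (src_src a.1)
  rng_src a := Subtype.ext (rng_src a.1)
  src_rng a := Subtype.ext (src_rng a.1)
  rng_rng a := Subtype.ext (rng_rng a.1)
  src_comp a b _ := Subtype.ext (src_comp a.1 b.1 _)
  rng_comp a b _ := Subtype.ext (rng_comp a.1 b.1 _)
  comp_assoc a b c _ _ h₁ h₂ := Subtype.ext (comp_assoc a.1 b.1 c.1 _ _
    (congrArg Subtype.val h₁) (congrArg Subtype.val h₂))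
  comp_src a _ := Subtype.ext (comp_src a.1 _)
  rng_comp_self a _ := Subtype.ext (rng_comp_self a.1 _)
  src_inv a := Subtype.ext (src_inv a.1)
  rng_inv a := Subtype.ext (rng_inv a.1)
  inv_comp a _ := Subtype.ext (inv_comp a.1 _)
  comp_inv a _ := Subtype.ext (comp_inv a.1 _)

end Sub

/-- A topological groupoid: inversion is continuous, and so is composition on the space of
composable pairs. -/
class IsTopologicalGroupoid (G : Type u) [TopologicalSpace G] [ArrowGroupoid G] : Prop where
  continuous_inv : Continuous (inv : G → G)
  continuous_comp :
    Continuous (fun p : {p : G × G // src p.1 = rng p.2} => comp p.1.1 p.1.2 p.2)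

/-- An étale groupoid: a topological groupoid whose unit space is locally compact Hausdorff and
whose source map `G → G⁽⁰⁾` is a local homeomorphism. -/
class IsEtaleGroupoid (G : Type u) [TopologicalSpace G] [ArrowGroupoid G] : Prop
    extends IsTopologicalGroupoid G where
  locallyCompact_unitSpace : LocallyCompactSpace (unitSpace G)
  t2_unitSpace : T2Space (unitSpace G)
  isLocalHomeomorph_src : IsLocalHomeomorph (srcUnit : G → unitSpace G)

/-- An open bisection: an open set on which the source and range maps are homeomorphisms onto open
subsets of the unit space. -/
structure IsOpenBisection {G : Type u} [TopologicalSpace G] [ArrowGroupoid G] (U : Set G) :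
    Prop where
  isOpen : IsOpen U
  src_isOpenEmbedding : Topology.IsOpenEmbedding (U.domRestrict (srcUnit : G → unitSpace G))
  rng_isOpenEmbedding : Topology.IsOpenEmbedding (U.domRestrict (rngUnit : G → unitSpace G))

/-- An ample groupoid: an étale groupoid with a base of compact open bisections. -/
class IsAmpleGroupoid (G : Type u) [TopologicalSpace G] [ArrowGroupoid G] : Prop
    extends IsEtaleGroupoid G where
  isTopologicalBasis :
    TopologicalSpace.IsTopologicalBasis {U : Set G | IsCompact U ∧ IsOpenBisection U}

section Bisections

variable {G : Type u} [TopologicalSpace G] [ArrowGroupoid G]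

theorem IsOpenBisection.src_inj {U : Set G} (hU : IsOpenBisection U) {a b : G} (ha : a ∈ U)
    (hb : b ∈ U) (h : src a = src b) : a = b :=
  congrArg Subtype.val
    (hU.src_isOpenEmbedding.injective (a₁ := ⟨a, ha⟩) (a₂ := ⟨b, hb⟩) (srcUnit_eq.2 h))

theorem IsOpenBisection.rng_inj {U : Set G} (hU : IsOpenBisection U) {a b : G} (ha : a ∈ U)
    (hb : b ∈ U) (h : rng a = rng b) : a = b :=
  congrArg Subtype.val
    (hU.rng_isOpenEmbedding.injective (a₁ := ⟨a, ha⟩) (a₂ := ⟨b, hb⟩) (rngUnit_eq.2 h))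

variable [IsEtaleGroupoid G]

theorem continuous_srcUnit : Continuous (srcUnit : G → unitSpace G) :=
  IsEtaleGroupoid.isLocalHomeomorph_src.continuous

theorem continuous_rngUnit : Continuous (rngUnit : G → unitSpace G) := by
  rw [rngUnit_eq_comp]
  exact continuous_srcUnit.comp IsTopologicalGroupoid.continuous_inv

theorem isOpenMap_srcUnit : IsOpenMap (srcUnit : G → unitSpace G) :=
  IsEtaleGroupoid.isLocalHomeomorph_src.isOpenMap

theorem isOpenMap_rngUnit : IsOpenMap (rngUnit : G → unitSpace G) := by
  rw [rngUnit_eq_comp]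
  refine isOpenMap_srcUnit.comp ?_
  exact (Homeomorph.mk ⟨inv, inv, inv_inv, inv_inv⟩ IsTopologicalGroupoid.continuous_inv
    IsTopologicalGroupoid.continuous_inv : G ≃ₜ G).isOpenMap

theorem isCompact_setMul {U V : Set G} (hU : IsCompact U) (hV : IsCompact V) :
    IsCompact (setMul U V) := by
  have ht2 := IsEtaleGroupoid.t2_unitSpace (G := G)
  have hcl : IsClosed {p : G × G | src p.1 = rng p.2} := by
    have : {p : G × G | src p.1 = rng p.2} =
        {p : G × G | srcUnit p.1 = rngUnit p.2} := by
      ext p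
      exact (Subtype.ext_iff (a1 := srcUnit p.1) (a2 := rngUnit p.2)).symm
    rw [this]
    exact isClosed_eq (continuous_srcUnit.comp continuous_fst)
      (continuous_rngUnit.comp continuous_snd)
  have hc := (hcl.isClosedEmbedding_subtypeVal.isCompact_preimage (hU.prod hV)).image
    (IsTopologicalGroupoid.continuous_comp (G := G))
  convert hc using 1
  ext γ
  constructor
  · rintro ⟨α, hα, β, hβ, h, rfl⟩
    exact ⟨⟨(α, β), h⟩, ⟨hα, hβ⟩, rfl⟩
  · rintro ⟨⟨⟨α, β⟩, h⟩, ⟨hα, hβ⟩, rfl⟩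
    exact ⟨α, hα, β, hβ, h, rfl⟩

theorem isOpen_setMul {U V : Set G} (hU : IsOpenBisection U) (hV : IsOpen V) :
    IsOpen (setMul U V) := by
  let f : U → unitSpace G := U.domRestrict rngUnit
  let e : U ≃ₜ Set.range f := hU.rng_isOpenEmbedding.isEmbedding.toHomeomorph
  let W : Set G := rngUnit ⁻¹' Set.range f
  have hW : IsOpen W := hU.rng_isOpenEmbedding.isOpen_range.preimage continuous_rngUnit
  let σ : W → G := fun γ => (e.symm ⟨rngUnit γ.1, γ.2⟩).1
  have hσ : Continuous σ := continuous_subtype_val.comp (e.symm.continuous.comp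
    ((continuous_rngUnit.comp continuous_subtype_val).subtype_mk _))
  have hσU : ∀ γ, σ γ ∈ U := fun γ => (e.symm ⟨rngUnit γ.1, γ.2⟩).2
  have hσr : ∀ γ, rng (σ γ) = rng γ.1 := fun γ => by
    have h1 : e (e.symm ⟨rngUnit γ.1, γ.2⟩) = ⟨rngUnit γ.1, γ.2⟩ := e.apply_symm_apply _
    exact congrArg (fun z : Set.range f => (z.1 : G)) h1
  have hc : ∀ γ : W, src (inv (σ γ)) = rng γ.1 := fun γ => (src_inv _).trans (hσr γ)
  let ψ : W → G := fun γ => comp (inv (σ γ)) γ.1 (hc γ)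
  have hψ : Continuous ψ := by
    have : Continuous fun γ : W =>
        (⟨(inv (σ γ), γ.1), hc γ⟩ : {p : G × G // src p.1 = rng p.2}) :=
      ((IsTopologicalGroupoid.continuous_inv.comp hσ).prodMk continuous_subtype_val).subtype_mk _
    exact IsTopologicalGroupoid.continuous_comp.comp this
  have : setMul U V = Subtype.val '' (ψ ⁻¹' V) := by
    ext γ
    constructor
    · rintro ⟨α, hα, β, hβ, h, rfl⟩
      have hw : comp α β h ∈ W := ⟨⟨α, hα⟩, Subtype.ext (rng_comp α β h).symm⟩
      refine ⟨⟨_, hw⟩, ?_, rfl⟩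
      have hσα : σ ⟨_, hw⟩ = α := hU.rng_inj (hσU _) hα ((hσr _).trans (rng_comp α β h))
      have : ψ ⟨_, hw⟩ = β := by
        simp only [ψ, hσα]
        exact inv_comp_comp α β h _
      rw [Set.mem_preimage, this]
      exact hβ
    · rintro ⟨γ, hγ, rfl⟩
      have h : src (σ γ) = rng (ψ γ) := by simp only [ψ, rng_comp, rng_inv]
      exact ⟨σ γ, hσU γ, ψ γ, hγ, h, comp_inv_comp (σ γ) γ.1 (hc γ) h⟩
  rw [this]
  exact hW.isOpenMap_subtype_val _ (hV.preimage hψ)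

theorem IsOpenBisection.setMul {U V : Set G} (hU : IsOpenBisection U) (hV : IsOpenBisection V) :
    IsOpenBisection (setMul U V) := by
  have ho := isOpen_setMul hU hV.isOpen
  refine ⟨ho, ?_, ?_⟩
  · refine Topology.IsOpenEmbedding.of_continuous_injective_isOpenMap
      (continuous_srcUnit.comp continuous_subtype_val) ?_
      (isOpenMap_srcUnit.comp ho.isOpenMap_subtype_val)
    rintro ⟨_, α, hα, β, hβ, h, rfl⟩ ⟨_, α', hα', β', hβ', h', rfl⟩ he
    have he' := srcUnit_eq.1 he
    simp only [src_comp] at he'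
    obtain rfl := hV.src_inj hβ hβ' he'
    obtain rfl := hU.src_inj hα hα' (h.trans h'.symm)
    rfl
  · refine Topology.IsOpenEmbedding.of_continuous_injective_isOpenMap
      (continuous_rngUnit.comp continuous_subtype_val) ?_
      (isOpenMap_rngUnit.comp ho.isOpenMap_subtype_val)
    rintro ⟨_, α, hα, β, hβ, h, rfl⟩ ⟨_, α', hα', β', hβ', h', rfl⟩ he
    have he' := rngUnit_eq.1 he
    simp only [rng_comp] at he'
    obtain rfl := hU.rng_inj hα hα' he'
    obtain rfl := hV.rng_inj hβ hβ' (h.symm.trans h')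
    rfl

end Bisections

/-! ### Steinberg algebras -/

section Convolution

variable {K : Type w} [Field K] {G : Type u} [ArrowGroupoid G]

/-- The convolution `(f * g)(γ) = ∑_{γ = αβ} f(α) g(β)`. -/
noncomputable def convolution (f g : G → K) (γ : G) : K :=
  ∑ᶠ p ∈ {p : G × G | ∃ h, comp p.1 p.2 h = γ}, f p.1 * g p.2

theorem smul_convolution (k : K) (f g : G → K) :
    convolution (k • f) g = k • convolution f g := by
  funext γ
  simp only [convolution, Pi.smul_apply, smul_eq_mul, mul_assoc]
  exact (mul_finsum_mem _ _).symm

theorem convolution_smul (k : K) (f g : G → K) :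
    convolution f (k • g) = k • convolution f g := by
  funext γ
  simp only [convolution, Pi.smul_apply, smul_eq_mul, mul_left_comm _ k]
  exact (mul_finsum_mem _ _).symm

theorem zero_convolution (g : G → K) : convolution 0 g = 0 := by
  funext γ
  simp [convolution]

theorem convolution_zero (g : G → K) : convolution g 0 = 0 := by
  funext γ
  simp [convolution]

end Convolution

section Steinberg

variable (K : Type w) [Field K] (G : Type u) [TopologicalSpace G] [ArrowGroupoid G]

/-- The span, inside the functions `G → K`, of the characteristic functions of the compact open
bisections. -/
def steinbergSubmodule : Submodule K (G → K) :=
  Submodule.span K {f | ∃ U : Set G, IsCompact U ∧ IsOpenBisection U ∧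
    f = U.indicator (fun _ => (1 : K))}

/-- The Steinberg algebra `A_K(G)`: as a `K`-vector space, the span of the characteristic functions
of the compact open bisections; its multiplication is the convolution product. -/
def SteinbergAlgebra : Type (max u w) := steinbergSubmodule K G

namespace SteinbergAlgebra

noncomputable instance : AddCommGroup (SteinbergAlgebra K G) :=
  inferInstanceAs (AddCommGroup (steinbergSubmodule K G))

noncomputable instance : Module K (SteinbergAlgebra K G) :=
  inferInstanceAs (Module K (steinbergSubmodule K G))

end SteinbergAlgebra

variable {K G}

theorem finite_of_mem_steinbergSubmodule {f : G → K} (hf : f ∈ steinbergSubmodule K G) (x : G) :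
    {α | rng α = x ∧ f α ≠ 0}.Finite := by
  induction hf using Submodule.span_induction with
  | mem f hf =>
    obtain ⟨U, -, hU, rfl⟩ := hf
    refine Set.Subsingleton.finite ?_
    rintro a ⟨ha, ha'⟩ b ⟨hb, hb'⟩
    exact hU.rng_inj (Set.mem_of_indicator_ne_zero ha') (Set.mem_of_indicator_ne_zero hb')
      (ha.trans hb.symm)
  | zero => simp
  | add f g _ _ hf hg =>
    refine (hf.union hg).subset ?_
    rintro a ⟨ha, ha'⟩
    by_contra h
    simp only [Set.mem_union, Set.mem_ofPred_eq, ha, true_and, not_or, not_not] at h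
    exact ha' (by rw [Pi.add_apply, h.1, h.2, add_zero])
  | smul k f _ hf =>
    refine hf.subset ?_
    rintro a ⟨ha, ha'⟩
    refine ⟨ha, fun h => ha' ?_⟩
    rw [Pi.smul_apply, h, smul_zero]

theorem finite_convolution {f : G → K} (hf : f ∈ steinbergSubmodule K G) (g : G → K) (γ : G) :
    ({p : G × G | ∃ h, comp p.1 p.2 h = γ} ∩
      Function.support fun p : G × G => f p.1 * g p.2).Finite := by
  refine Set.Finite.of_finite_image (f := Prod.fst)
    ((finite_of_mem_steinbergSubmodule hf (rng γ)).subset ?_) ?_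
  · rintro _ ⟨⟨α, β⟩, ⟨⟨h, rfl⟩, hs⟩, rfl⟩
    exact ⟨(rng_comp α β h).symm, left_ne_zero_of_mul hs⟩
  · rintro ⟨α, β⟩ ⟨⟨h, he⟩, -⟩ ⟨α', β'⟩ ⟨⟨h', he'⟩, -⟩ hh
    dsimp only at h he h' he' hh
    subst hh
    rw [comp_left_cancel h h' (he.trans he'.symm)]

theorem convolution_add {f : G → K} (hf : f ∈ steinbergSubmodule K G) (g g' : G → K) :
    convolution f (g + g') = convolution f g + convolution f g' := by
  funext γ
  simp only [convolution, Pi.add_apply, mul_add]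
  exact finsum_mem_add_distrib' (finite_convolution hf g γ) (finite_convolution hf g' γ)

theorem add_convolution {f f' : G → K} (hf : f ∈ steinbergSubmodule K G)
    (hf' : f' ∈ steinbergSubmodule K G) (g : G → K) :
    convolution (f + f') g = convolution f g + convolution f' g := by
  funext γ
  simp only [convolution, Pi.add_apply, add_mul]
  exact finsum_mem_add_distrib' (finite_convolution hf g γ) (finite_convolution hf' g γ)

theorem convolution_indicator {U V : Set G} (hU : IsOpenBisection U) :
    convolution (U.indicator fun _ => (1 : K)) (V.indicator fun _ => (1 : K)) =
      (setMul U V).indicator fun _ => (1 : K) := by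
  classical
  funext γ
  by_cases hγ : γ ∈ setMul U V
  · rw [Set.indicator_of_mem hγ]
    obtain ⟨α, hα, β, hβ, h, rfl⟩ := hγ
    rw [convolution, finsum_mem_inter_support_eq _ _ {(α, β)}, finsum_mem_singleton,
      Set.indicator_of_mem hα, Set.indicator_of_mem hβ, one_mul]
    ext ⟨α', β'⟩
    constructor
    · rintro ⟨⟨h', he⟩, hs⟩
      refine ⟨?_, hs⟩
      dsimp only at h' he
      have hα' := Set.mem_of_indicator_ne_zero (left_ne_zero_of_mul hs)
      obtain rfl : α' = α := hU.rng_inj hα' hα (by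
        rw [← rng_comp α' β' h', he, rng_comp])
      rw [comp_left_cancel h' h he]
      rfl
    · rintro ⟨he, hs⟩
      refine ⟨?_, hs⟩
      rw [Set.mem_singleton_iff] at he
      rw [he]
      exact ⟨h, rfl⟩
  · rw [Set.indicator_of_notMem hγ, convolution]
    refine finsum_mem_eq_zero_of_forall_eq_zero ?_
    rintro ⟨α, β⟩ ⟨h, rfl⟩
    by_contra hne
    exact hγ ⟨α, Set.mem_of_indicator_ne_zero (left_ne_zero_of_mul hne), β,
      Set.mem_of_indicator_ne_zero (right_ne_zero_of_mul hne), h, rfl⟩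

theorem convolution_mem [IsEtaleGroupoid G] {f g : G → K} (hf : f ∈ steinbergSubmodule K G)
    (hg : g ∈ steinbergSubmodule K G) : convolution f g ∈ steinbergSubmodule K G := by
  induction hf, hg using Submodule.span_induction₂ with
  | mem_mem f g hf hg =>
    obtain ⟨U, hUc, hU, rfl⟩ := hf
    obtain ⟨V, hVc, hV, rfl⟩ := hg
    exact Submodule.subset_span
      ⟨_, isCompact_setMul hUc hVc, hU.setMul hV, convolution_indicator hU⟩
  | zero_left g _ => rw [zero_convolution]; exact Submodule.zero_mem _
  | zero_right f _ => rw [convolution_zero]; exact Submodule.zero_mem _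
  | add_left f f' g hf hf' _ h h' =>
    rw [add_convolution hf hf']; exact Submodule.add_mem _ h h'
  | add_right f g g' hf _ _ h h' =>
    rw [convolution_add hf]; exact Submodule.add_mem _ h h'
  | smul_left k f g _ _ h => rw [smul_convolution]; exact Submodule.smul_mem _ _ h
  | smul_right k f g _ _ h => rw [convolution_smul]; exact Submodule.smul_mem _ _ h

theorem convolution_assoc [IsEtaleGroupoid G] {f g k : G → K} (hf : f ∈ steinbergSubmodule K G)
    (hg : g ∈ steinbergSubmodule K G) (hk : k ∈ steinbergSubmodule K G) :
    convolution (convolution f g) k = convolution f (convolution g k) := by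
  induction hk using Submodule.span_induction with
  | zero => simp only [convolution_zero]
  | add k k' hk hk' h h' =>
    rw [convolution_add (convolution_mem hf hg), convolution_add hg, convolution_add hf, h, h']
  | smul c k _ h => rw [convolution_smul, convolution_smul, convolution_smul, h]
  | mem k hk =>
    have hk' : k ∈ steinbergSubmodule K G := Submodule.subset_span hk
    obtain ⟨W, hWc, hW, rfl⟩ := hk
    induction hf, hg using Submodule.span_induction₂ with
    | mem_mem f g hf hg =>
      obtain ⟨U, hUc, hU, rfl⟩ := hf
      obtain ⟨V, hVc, hV, rfl⟩ := hg
      rw [convolution_indicator hU, convolution_indicator hV,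
        convolution_indicator (hU.setMul hV), convolution_indicator hU, setMul_assoc]
    | zero_left g _ => simp only [zero_convolution]
    | zero_right f _ => simp only [zero_convolution, convolution_zero]
    | add_left f f' g hf hf' hg h h' =>
      rw [add_convolution hf hf', add_convolution (convolution_mem hf hg)
        (convolution_mem hf' hg), add_convolution hf hf', h, h']
    | add_right f g g' hf hg hg' h h' =>
      rw [convolution_add hf, add_convolution (convolution_mem hf hg)
        (convolution_mem hf hg'), add_convolution hg hg', convolution_add hf, h, h']
    | smul_left c f g _ _ h => simp only [smul_convolution, h]
    | smul_right c f g _ _ h => simp only [smul_convolution, convolution_smul, h]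

namespace SteinbergAlgebra

variable [IsAmpleGroupoid G]

noncomputable instance : NonUnitalRing (SteinbergAlgebra K G) where
  mul f g := ⟨convolution f.1 g.1, convolution_mem f.2 g.2⟩
  left_distrib f g h := Subtype.ext (convolution_add f.2 g.1 h.1)
  right_distrib f g h := Subtype.ext (add_convolution f.2 g.2 h.1)
  zero_mul f := Subtype.ext (zero_convolution f.1)
  mul_zero f := Subtype.ext (convolution_zero f.1)
  mul_assoc f g h := Subtype.ext (convolution_assoc f.2 g.2 h.2)

instance : IsScalarTower K (SteinbergAlgebra K G) (SteinbergAlgebra K G) where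
  smul_assoc k f g := Subtype.ext (smul_convolution k f.1 g.1)

instance : SMulCommClass K (SteinbergAlgebra K G) (SteinbergAlgebra K G) where
  smul_comm k f g := Subtype.ext (convolution_smul k f.1 g.1).symm

end SteinbergAlgebra

end Steinberg

end ArrowGroupoid

/-! ### The graph groupoid and its restrictions -/

namespace DirectedGraph

variable {V : Type u} {E : Type v} {Γ : DirectedGraph V E}

/-- The groupoid structure on the set of triples: `(a, k, b)` has range `a` and source `b`, and
`(a, k, b) (b, l, c) = (a, k + l, c)`, `(a, k, b)⁻¹ = (b, -k, a)`; the object `a` is identified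
with `(a, 0, a)`. -/
instance : ArrowGroupoid Γ.GraphGroupoid where
  src g := ⟨g.source, 0, g.source, _, _, _, isTriple_refl g.source⟩
  rng g := ⟨g.target, 0, g.target, _, _, _, isTriple_refl g.target⟩
  inv g := ⟨g.source, -g.deg, g.target, by
    obtain ⟨α, β, x, h⟩ := g.exists_triple
    exact ⟨β, α, x, h.symm⟩⟩
  comp g g' h := ⟨g.target, g.deg + g'.deg, g'.source, by
    obtain ⟨α, β, x, hx⟩ := g.exists_triple
    obtain ⟨γ, δ, y, hy⟩ := g'.exists_triple
    have he : g.source = g'.target := congrArg GraphGroupoid.source h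
    rw [← he] at hy
    exact hx.comp hy⟩
  src_src _ := rfl
  rng_src _ := rfl
  src_rng _ := rfl
  rng_rng _ := rfl
  src_comp _ _ _ := rfl
  rng_comp _ _ _ := rfl
  comp_assoc _ _ _ _ _ _ _ := GraphGroupoid.ext rfl (add_assoc _ _ _) rfl
  comp_src _ _ := GraphGroupoid.ext rfl (add_zero _) rfl
  rng_comp_self _ _ := GraphGroupoid.ext rfl (zero_add _) rfl
  src_inv _ := rfl
  rng_inv _ := rfl
  inv_comp _ _ := GraphGroupoid.ext rfl (neg_add_cancel _) rfl
  comp_inv _ _ := GraphGroupoid.ext rfl (add_neg_cancel _) rfl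

variable (Γ) in
/-- The restriction of the graph groupoid to a set `H` of vertices: the set of all triples
`(αx, |α| - |β|, βx)` with `s(α), s(β) ∈ H`. -/
def restrictSet (H : Set V) : Set Γ.GraphGroupoid :=
  {g | ∃ (α β : Γ.FinPath) (x : Γ.BoundaryPath),
    IsTriple α β x g.target g.deg g.source ∧ α.start ∈ H ∧ β.start ∈ H}

theorem mem_restrictSet {H : Set V} {g : Γ.GraphGroupoid} :
    g ∈ Γ.restrictSet H ↔ g.target.1.start ∈ H ∧ g.source.1.start ∈ H := by
  constructor
  · rintro ⟨α, β, x, ⟨hα, hβ, ha, -, hb⟩, h, h'⟩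
    rw [ha, hb, FinPath.start_concat, FinPath.start_concat]
    exact ⟨h, h'⟩
  · obtain ⟨α, β, x, hx⟩ := g.exists_triple
    have hx' := hx
    obtain ⟨hα, hβ, ha, -, hb⟩ := hx'
    rw [ha, hb, FinPath.start_concat, FinPath.start_concat]
    exact fun h => ⟨α, β, x, hx, h.1, h.2⟩

variable (Γ) in
/-- The subgroupoid of the graph groupoid with set of arrows `restrictSet`. -/
def restrict (H : Set V) : ArrowGroupoid.Subgroupoid Γ.GraphGroupoid where
  carrier := Γ.restrictSet H
  inv_mem g hg := by
    rw [mem_restrictSet] at hg ⊢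
    exact ⟨hg.2, hg.1⟩
  comp_mem g hg g' hg' h := by
    rw [mem_restrictSet] at hg hg' ⊢
    exact ⟨hg.1, hg'.2⟩

end DirectedGraph

/-!
The Leavitt path algebra `L_K(Γ)` maps to the Steinberg algebra of the graph groupoid by sending
`α β*` to the characteristic function of the cylinder `Z(α, β)`; the theorem follows from the facts
that this map (`toSteinberg`) is an isomorphism, and that the restriction to `H` cuts out, on both
sides, the span of the elements with `s(α), s(β) ∈ H`.

To keep dependent types out of the way, cylinders are indexed by lists of edges: `cyl Γ v l m` is
the set of arrows `(l x, |l| - |m|, m x)` with `s(x) = v`, and it is empty if `l` or `m` is not a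
path ending at `v`. In the same way, `leavittMonomial Γ K v l m` is `α β*`, or zero.

*Topology.* Two cylinders are nested or disjoint (`cyl_factor`, `cyl_subset`). Hence the sets
`Z(α, β, F)` form a basis, cylinders are clopen, and they separate points. An ultrafilter containing
a cylinder converges to the arrow given by the decreasing chain of cylinders that it contains, so
cylinders are compact (`isCompact_cyl`). Source and range are injective on cylinders and the source
map is open, which makes the groupoid and its restrictions to open subgroupoids ample
(`isAmpleGroupoid_of_basis`); the restriction to `H` is even clopen.

*Surjectivity.* The span of the characteristic functions of cylinders is closed under pointwise
products, so that it contains the characteristic functions of finite unions of the sets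
`Z(α, β, F)`, and these are all the compact open sets (`indicator_mem_cylSpan`).

*Injectivity.* Let `x` be a combination of monomials `α β*` with `|α| ≤ n + 1` that is mapped to
zero. Then `e* x` is a combination of monomials with `|α| ≤ n`, so it vanishes by induction. It
suffices to treat `x = v x`. If `v` is regular, then `x = ∑ e e* x = 0`. Otherwise `v` itself is a
boundary path, and evaluation at the arrows `(v, -|β|, β)` shows that the terms `β*` with `|α| = 0`
do not occur in `x`, so that `x` is again a sum of elements `e e* x`. The induction starts with
combinations of monomials `β*`, which are linearly independent because every vertex is the source
of a boundary path.

*Corners.* `cornerLike K H` is the span of the monomials with `s(α), s(β) ∈ H`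
(`mem_cornerLike_iff`), and it is the corner of the idempotent `∑ v ∈ H, v` if `H` is finite.
Functions in the image of this span are supported on the restricted groupoid, so that restricting
them to it is injective and multiplicative.
-/

universe u'

namespace DirectedGraph

variable {V : Type u} {E : Type v} {Γ : DirectedGraph V E}

/-! ### Concatenation of paths -/

/-- `IsCons e x y` says that `y = e x`. -/
def IsCons (e : E) (x y : Γ.Path) : Prop :=
  ∃ h : (FinPath.edge Γ e).finish = x.start, y = (FinPath.edge Γ e).concat x h

theorem IsCons.start_right {e : E} {x y : Γ.Path} (h : IsCons e x y) : y.start = Γ.src e := by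
  obtain ⟨h, rfl⟩ := h
  exact FinPath.start_concat _ _ _

theorem IsCons.start_left {e : E} {x y : Γ.Path} (h : IsCons e x y) : x.start = Γ.rng e :=
  h.1.symm

theorem exists_isCons {e : E} {x : Γ.Path} (h : x.start = Γ.rng e) : ∃ y, IsCons e x y :=
  ⟨_, h.symm, rfl⟩

theorem IsCons.unique {e : E} {x y y' : Γ.Path} (h : IsCons e x y) (h' : IsCons e x y') :
    y = y' := by
  obtain ⟨_, rfl⟩ := h
  obtain ⟨_, rfl⟩ := h'
  rfl

theorem IsCons.inj {e f : E} {x x' y : Γ.Path} (h : IsCons e x y) (h' : IsCons f x' y) :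
    e = f ∧ x = x' := by
  obtain ⟨h, rfl⟩ := h
  obtain ⟨h', he⟩ := h'
  cases x with
  | fin x =>
    cases x' with
    | inf x' => simp [FinPath.concat] at he
    | fin x' =>
      have he : e :: x.edges = f :: x'.edges := congrArg FinPath.edges (Path.fin.inj he)
      obtain rfl : e = f := (List.cons.inj he).1
      exact ⟨rfl, congrArg _ (FinPath.ext (Eq.trans (Eq.symm h) h') (List.cons.inj he).2)⟩
  | inf x =>
    cases x' with
    | fin x' => simp [FinPath.concat] at he
    | inf x' =>
      have he : x.edges.cons e = x'.edges.cons f := congrArg InfPath.edges (Path.inf.inj he)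
      exact ⟨congrArg Stream'.head he, congrArg _ (InfPath.ext (congrArg Stream'.tail he))⟩

theorem IsCons.isBoundary_iff {e : E} {x y : Γ.Path} (h : IsCons e x y) :
    Γ.IsBoundary y ↔ Γ.IsBoundary x := by
  obtain ⟨h, rfl⟩ := h
  cases x with
  | fin x =>
    have := FinPath.finish_append (FinPath.edge Γ e) x h
    simp only [FinPath.concat, IsBoundary, this]
  | inf x => exact Iff.rfl

theorem IsCons.ne_vertex {e : E} {x y : Γ.Path} (h : IsCons e x y) (v : V) :
    y ≠ .fin (FinPath.vertex Γ v) := by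
  rintro rfl
  obtain ⟨h, he⟩ := h
  cases x with
  | fin x =>
    have he : [] = e :: x.edges := congrArg FinPath.edges (Path.fin.inj he)
    simp at he
  | inf x => simp [FinPath.concat] at he

/-- A path is a vertex or starts with an edge. -/
theorem exists_isCons_or_eq_vertex (x : Γ.Path) :
    (∃ e y, IsCons e y x) ∨ x = .fin (FinPath.vertex Γ x.start) := by
  cases x with
  | fin x =>
    obtain ⟨v, l, hl⟩ := x
    cases l with
    | nil => exact Or.inr rfl
    | cons e l =>
      exact Or.inl ⟨e, .fin ⟨Γ.rng e, l, hl.2⟩, rfl, congrArg _ (FinPath.ext hl.1.symm rfl)⟩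
  | inf x =>
    refine Or.inl ⟨x.edges.head, .inf ⟨x.edges.tail, fun n => x.chain (n + 1)⟩, x.chain 0, ?_⟩
    exact congrArg _ (InfPath.ext (Stream'.cons_head_tail _).symm)

/-- `IsConcat l x y` says that `y = l x`, where `l` is a list of edges. -/
def IsConcat : List E → Γ.Path → Γ.Path → Prop
  | [], x, y => x = y
  | e :: l, x, y => ∃ z, IsConcat l x z ∧ IsCons e z y

/-- The source of the path with the edges `l` that ends at `v`; whether `l` is such a path is not
checked. -/
def listStart (Γ : DirectedGraph V E) (v : V) : List E → V
  | [] => v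
  | e :: _ => Γ.src e

theorem isConcat_append {l m : List E} {x y : Γ.Path} :
    IsConcat (l ++ m) x y ↔ ∃ z, IsConcat m x z ∧ IsConcat l z y := by
  induction l generalizing y with
  | nil => simp [IsConcat]
  | cons e l ih =>
    simp only [List.cons_append, IsConcat, ih]
    constructor
    · rintro ⟨z, ⟨t, h1, h2⟩, h3⟩
      exact ⟨t, h1, z, h2, h3⟩
    · rintro ⟨t, h1, z, h2, h3⟩
      exact ⟨z, ⟨t, h1, h2⟩, h3⟩

theorem isConcat_singleton {e : E} {x y : Γ.Path} : IsConcat [e] x y ↔ IsCons e x y := by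
  simp [IsConcat]

theorem IsConcat.start {l : List E} {x y : Γ.Path} (h : IsConcat l x y) :
    y.start = Γ.listStart x.start l := by
  cases l with
  | nil => exact congrArg _ h.symm
  | cons e l => obtain ⟨z, -, h⟩ := h; exact h.start_right

theorem IsConcat.unique {l : List E} {x y y' : Γ.Path} (h : IsConcat l x y)
    (h' : IsConcat l x y') : y = y' := by
  induction l generalizing y y' with
  | nil => exact h.symm.trans h'
  | cons e l ih =>
    obtain ⟨z, h1, h2⟩ := h
    obtain ⟨z', h1', h2'⟩ := h'
    obtain rfl := ih h1 h1'
    exact h2.unique h2'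

/-- Two factorizations of one path: the shorter of the initial segments is an initial segment of
the longer one. -/
theorem IsConcat.factor {l m : List E} {x y z : Γ.Path} (h : IsConcat l x z)
    (h' : IsConcat m y z) (hlm : l.length ≤ m.length) : ∃ k, m = l ++ k ∧ IsConcat k y x := by
  induction l generalizing m z with
  | nil => obtain rfl : x = z := h; exact ⟨m, rfl, h'⟩
  | cons e l ih =>
    cases m with
    | nil => simp at hlm
    | cons f m =>
      obtain ⟨z₁, h1, h2⟩ := h
      obtain ⟨z₂, h3, h4⟩ := h'
      obtain ⟨rfl, rfl⟩ := h2.inj h4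
      obtain ⟨k, rfl, hk⟩ := ih h1 h3 (by simpa using hlm)
      exact ⟨k, rfl, hk⟩

theorem IsConcat.inj {l m : List E} {x y z : Γ.Path} (h : IsConcat l x z) (h' : IsConcat m y z)
    (hlm : l.length = m.length) : l = m ∧ x = y := by
  obtain ⟨k, rfl, hk⟩ := h.factor h' hlm.le
  obtain rfl : k = [] := by simpa using hlm
  exact ⟨(List.append_nil l).symm, Eq.symm hk⟩

theorem IsConcat.isBoundary_iff {l : List E} {x y : Γ.Path} (h : IsConcat l x y) :
    Γ.IsBoundary y ↔ Γ.IsBoundary x := by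
  induction l generalizing y with
  | nil => obtain rfl : x = y := h; rfl
  | cons e l ih => obtain ⟨z, h1, h2⟩ := h; exact h2.isBoundary_iff.trans (ih h1)

/-- Whether `l x` makes sense depends only on the source of `x`. -/
theorem IsConcat.exists_of_start_eq {l : List E} {x y x' : Γ.Path} (h : IsConcat l x y)
    (hx : x'.start = x.start) : ∃ y', IsConcat l x' y' := by
  induction l generalizing y with
  | nil => exact ⟨x', rfl⟩
  | cons e l ih =>
    obtain ⟨z, h1, h2⟩ := h
    obtain ⟨z', hz'⟩ := ih h1
    obtain ⟨y', hy'⟩ := exists_isCons (e := e) (x := z')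
      (by rw [hz'.start, hx, ← h1.start, h2.start_left])
    exact ⟨y', z', hz', hy'⟩

theorem IsConcat.eq_nil_of_vertex {l : List E} {x : Γ.Path} {v : V}
    (h : IsConcat l x (.fin (FinPath.vertex Γ v))) : l = [] := by
  cases l with
  | nil => rfl
  | cons e l => obtain ⟨z, -, h⟩ := h; exact absurd rfl (h.ne_vertex v)

theorem FinPath.isConcat_concat (α : Γ.FinPath) (x : Γ.Path) (h : α.finish = x.start) :
    IsConcat α.edges x (α.concat x h) := by
  obtain ⟨v, l, hl⟩ := α
  induction l generalizing v with
  | nil => exact (FinPath.vertex_concat x v h).symm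
  | cons e l ih =>
    have h' : (⟨Γ.rng e, l, hl.2⟩ : Γ.FinPath).finish = x.start := h
    refine ⟨_, ih (Γ.rng e) hl.2 h', ?_⟩
    have h₂ : (FinPath.edge Γ e).finish =
        ((⟨Γ.rng e, l, hl.2⟩ : Γ.FinPath).concat x h').start := by
      rw [FinPath.start_concat]; rfl
    refine ⟨h₂, ?_⟩
    rw [← FinPath.append_concat (FinPath.edge Γ e) ⟨Γ.rng e, l, hl.2⟩ x rfl h' h h₂]
    congr 1
    exact FinPath.ext hl.1.symm rfl

theorem IsConcat.isWalk {l : List E} {x y : Γ.Path} (h : IsConcat l x y) :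
    Γ.IsWalk y.start l ∧ Γ.walkEnd y.start l = x.start := by
  induction l generalizing y with
  | nil => obtain rfl : x = y := h; exact ⟨trivial, rfl⟩
  | cons e l ih =>
    obtain ⟨z, h1, h2⟩ := h
    have := ih h1
    rw [h2.start_left] at this
    exact ⟨⟨h2.start_right.symm, this.1⟩, this.2⟩

theorem IsConcat.exists_finPath {l : List E} {x y : Γ.Path} (h : IsConcat l x y) :
    ∃ α : Γ.FinPath, α.edges = l ∧ α.finish = x.start ∧ α.start = y.start :=
  ⟨⟨y.start, l, h.isWalk.1⟩, rfl, h.isWalk.2, rfl⟩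

theorem isTriple_iff {α β : Γ.FinPath} {x a b : Γ.BoundaryPath} {k : ℤ} :
    IsTriple α β x a k b ↔ α.finish = x.1.start ∧ β.finish = x.1.start ∧
      IsConcat α.edges x.1 a.1 ∧ k = (α.edges.length : ℤ) - β.edges.length ∧
      IsConcat β.edges x.1 b.1 := by
  constructor
  · rintro ⟨hα, hβ, ha, hk, hb⟩
    refine ⟨hα, hβ, ?_, hk, ?_⟩
    · rw [ha]; exact α.isConcat_concat _ _
    · rw [hb]; exact β.isConcat_concat _ _
  · rintro ⟨hα, hβ, ha, hk, hb⟩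
    exact ⟨hα, hβ, ha.unique (α.isConcat_concat _ hα), hk, hb.unique (β.isConcat_concat _ hβ)⟩

/-! ### Cylinders -/

/-- The set of all arrows `(l x, |l| - |m|, m x)` with `x` a path with source `v`. It is the set
`Z(α, β)` if `l` and `m` are the edges of paths `α` and `β` with range `v`, and is empty if there
are no such paths. -/
def cyl (Γ : DirectedGraph V E) (v : V) (l m : List E) : Set Γ.GraphGroupoid :=
  {g | ∃ x : Γ.Path, x.start = v ∧ IsConcat l x g.target.1 ∧
    g.deg = (l.length : ℤ) - m.length ∧ IsConcat m x g.source.1}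

theorem cylinder_eq_cyl (α β : Γ.FinPath) (h : α.finish = β.finish) :
    cylinder α β = Γ.cyl α.finish α.edges β.edges := by
  ext g
  constructor
  · rintro ⟨x, hx⟩
    obtain ⟨h1, h2, h3, h4, h5⟩ := isTriple_iff.1 hx
    exact ⟨x.1, h1.symm, h3, h4, h5⟩
  · rintro ⟨x, h1, h3, h4, h5⟩
    exact ⟨⟨x, h3.isBoundary_iff.1 g.target.2⟩,
      isTriple_iff.2 ⟨h1.symm, h.symm.trans h1.symm, h3, h4, h5⟩⟩

theorem GraphGroupoid.ext_path {g g' : Γ.GraphGroupoid} (h₁ : g.target.1 = g'.target.1)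
    (h₂ : g.deg = g'.deg) (h₃ : g.source.1 = g'.source.1) : g = g' :=
  GraphGroupoid.ext (Subtype.ext h₁) h₂ (Subtype.ext h₃)

theorem exists_mem_cyl {l m : List E} {x a b : Γ.Path} (hx : Γ.IsBoundary x)
    (ha : IsConcat l x a) (hb : IsConcat m x b) :
    ∃ g ∈ Γ.cyl x.start l m, g.target.1 = a ∧ g.source.1 = b := by
  obtain ⟨α, hα, hα', -⟩ := ha.exists_finPath
  obtain ⟨β, hβ, hβ', -⟩ := hb.exists_finPath
  refine ⟨⟨⟨a, ha.isBoundary_iff.2 hx⟩, (l.length : ℤ) - m.length, ⟨b, hb.isBoundary_iff.2 hx⟩,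
    α, β, ⟨x, hx⟩, isTriple_iff.2 ⟨hα', hβ', ?_, ?_, ?_⟩⟩, ⟨x, rfl, ha, rfl, hb⟩, rfl, rfl⟩
  · rwa [hα]
  · rw [hα, hβ]
  · rwa [hβ]

theorem exists_cyl (g : Γ.GraphGroupoid) : ∃ v l m, g ∈ Γ.cyl v l m := by
  obtain ⟨α, β, x, hx⟩ := g.exists_triple
  obtain ⟨h1, h2, h3, h4, h5⟩ := isTriple_iff.1 hx
  exact ⟨_, _, _, x.1, rfl, h3, h4, h5⟩

theorem start_target_of_mem_cyl {v : V} {l m : List E} {g : Γ.GraphGroupoid}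
    (h : g ∈ Γ.cyl v l m) : g.target.1.start = Γ.listStart v l := by
  obtain ⟨x, rfl, h1, -, -⟩ := h
  exact h1.start

theorem start_source_of_mem_cyl {v : V} {l m : List E} {g : Γ.GraphGroupoid}
    (h : g ∈ Γ.cyl v l m) : g.source.1.start = Γ.listStart v m := by
  obtain ⟨x, rfl, -, -, h1⟩ := h
  exact h1.start

/-- If two cylinders meet, one of them is obtained from the other by prolonging both paths by the
same edges. -/
theorem cyl_factor {v w : V} {l m l' m' : List E} {g : Γ.GraphGroupoid} (h : g ∈ Γ.cyl v l m)
    (h' : g ∈ Γ.cyl w l' m') (hl : l.length ≤ l'.length) :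
    ∃ k, l' = l ++ k ∧ m' = m ++ k ∧ Γ.listStart w k = v := by
  obtain ⟨x, rfl, h1, h2, h3⟩ := h
  obtain ⟨y, rfl, h1', h2', h3'⟩ := h'
  obtain ⟨k, rfl, hk⟩ := h1.factor h1' hl
  obtain ⟨k', rfl, hk'⟩ := h3.factor h3' (by simp only [List.length_append] at *; omega)
  refine ⟨k, rfl, ?_, hk.start.symm⟩
  obtain ⟨z, hz⟩ := hk.exists_of_start_eq rfl
  obtain ⟨j, hj, hj'⟩ := hk.factor hk' (by simp only [List.length_append] at *; omega)
  obtain rfl : j = [] := by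
    have := congrArg List.length hj
    simp only [List.length_append] at *
    exact List.eq_nil_of_length_eq_zero (by omega)
  rw [hj, List.append_nil]

theorem mem_cyl_append {v w : V} {l m k : List E} {g : Γ.GraphGroupoid}
    (h : g ∈ Γ.cyl w (l ++ k) (m ++ k)) (hv : Γ.listStart w k = v) : g ∈ Γ.cyl v l m := by
  obtain ⟨y, rfl, h1, h2, h3⟩ := h
  obtain ⟨z, hz, h1⟩ := isConcat_append.1 h1
  obtain ⟨z', hz', h3⟩ := isConcat_append.1 h3
  obtain rfl := hz.unique hz'
  refine ⟨z, hz.start.trans hv, h1, ?_, h3⟩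
  simp only [List.length_append] at h2
  push_cast at h2
  omega

theorem cyl_subset {v w : V} {l m l' m' : List E} {g : Γ.GraphGroupoid} (h : g ∈ Γ.cyl v l m)
    (h' : g ∈ Γ.cyl w l' m') (hl : l.length ≤ l'.length) : Γ.cyl w l' m' ⊆ Γ.cyl v l m := by
  obtain ⟨k, rfl, rfl, hk⟩ := cyl_factor h h' hl
  exact fun g hg => mem_cyl_append hg hk

/-- A cylinder without the arrows whose common tail starts with one of the edges in `F`. Edges in
`F` whose source is not `v` have no effect. -/
def cylDiff (Γ : DirectedGraph V E) (v : V) (l m : List E) (F : Finset E) :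
    Set Γ.GraphGroupoid :=
  Γ.cyl v l m \ ⋃ e ∈ F, Γ.cyl (Γ.rng e) (l ++ [e]) (m ++ [e])

theorem mem_cylDiff {v : V} {l m : List E} {F : Finset E} {g : Γ.GraphGroupoid} :
    g ∈ Γ.cylDiff v l m F ↔
      g ∈ Γ.cyl v l m ∧ ∀ e ∈ F, g ∉ Γ.cyl (Γ.rng e) (l ++ [e]) (m ++ [e]) := by
  simp [cylDiff]

theorem cylDiff_subset {v : V} {l m : List E} {F : Finset E} :
    Γ.cylDiff v l m F ⊆ Γ.cyl v l m := Set.sdiff_subset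

theorem cylDiff_empty (v : V) (l m : List E) : Γ.cylDiff v l m ∅ = Γ.cyl v l m := by
  simp [cylDiff]

theorem cylinderDiff_eq (α β : Γ.FinPath) (h : α.finish = β.finish) (F : Finset E)
    (hF : ∀ e ∈ F, Γ.src e = α.finish) :
    cylinderDiff α β h F hF = Γ.cylDiff α.finish α.edges β.edges F := by
  rw [cylinderDiff, cylDiff, cylinder_eq_cyl α β h]
  congr 1
  refine Set.iUnion_congr fun e => Set.iUnion_congr fun he => ?_
  have hα := α.finish_append (FinPath.edge Γ e) (hF e he).symm
  have hβ := β.finish_append (FinPath.edge Γ e) (h.symm.trans (hF e he).symm)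
  exact (cylinder_eq_cyl _ _ (hα.trans hβ.symm)).trans
    (congrArg (fun v => Γ.cyl v (α.edges ++ [e]) (β.edges ++ [e])) hα)

/-- The sets `cylDiff` are the generating open sets `Z(α, β, F)`, up to the empty set and to edges
in `F` that have no effect. -/
theorem isOpen_cylDiff (v : V) (l m : List E) (F : Finset E) : IsOpen (Γ.cylDiff v l m F) := by
  classical
  by_cases hne : (Γ.cyl v l m).Nonempty
  · obtain ⟨g, x, rfl, h1, h2, h3⟩ := hne
    obtain ⟨α, hα, hα', -⟩ := h1.exists_finPath
    obtain ⟨β, hβ, hβ', -⟩ := h3.exists_finPath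
    have : Γ.cylDiff x.start l m F = cylinderDiff α β (hα'.trans hβ'.symm)
        (F.filter fun e => Γ.src e = α.finish) (fun e he => (Finset.mem_filter.1 he).2) := by
      rw [cylinderDiff_eq, hα, hβ, hα']
      ext g
      simp only [mem_cylDiff, Finset.mem_filter, and_imp]
      refine and_congr_right fun hg => forall₂_congr fun e _ => ?_
      refine ⟨fun h _ => h, fun h h' => h ?_ h'⟩
      obtain ⟨k, hk, -, hk'⟩ := cyl_factor hg h' (by simp)
      obtain rfl := List.append_cancel_left hk
      exact hk'
    rw [this]
    exact TopologicalSpace.isOpen_generateFrom_of_mem ⟨_, _, _, _, _, rfl⟩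
  · rw [Set.not_nonempty_iff_eq_empty] at hne
    rw [cylDiff, hne, Set.empty_sdiff]
    exact isOpen_empty

theorem isOpen_cyl (v : V) (l m : List E) : IsOpen (Γ.cyl v l m) := by
  rw [← cylDiff_empty]
  exact isOpen_cylDiff v l m ∅

theorem topology_eq : (inferInstance : TopologicalSpace Γ.GraphGroupoid) =
    TopologicalSpace.generateFrom {S | ∃ v l m F, S = Γ.cylDiff v l m F} := by
  apply le_antisymm
  · apply le_generateFrom
    rintro _ ⟨v, l, m, F, rfl⟩
    exact isOpen_cylDiff v l m F
  · apply le_generateFrom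
    rintro _ ⟨α, β, h, F, hF, rfl⟩
    exact TopologicalSpace.isOpen_generateFrom_of_mem ⟨_, _, _, _, cylinderDiff_eq α β h F hF⟩

open TopologicalSpace

/-! ### Separating and constructing boundary paths -/

/-- The infinite path traced out by iterating a map `next` on a set of states, each of which has a
vertex and an edge leaving it. -/
def InfPath.iterate {S : Type*} (vert : S → V) (f : S → E) (next : S → S)
    (hsrc : ∀ s, Γ.src (f s) = vert s) (hrng : ∀ s, vert (next s) = Γ.rng (f s)) (s : S) :
    Γ.InfPath where
  edges := fun n => f (next^[n] s)
  chain n := by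
    change Γ.rng (f (next^[n] s)) = Γ.src (f (next^[n + 1] s))
    rw [hsrc, Function.iterate_succ_apply', hrng]

theorem InfPath.isCons_iterate {S : Type*} (vert : S → V) (f : S → E) (next : S → S)
    (hsrc : ∀ s, Γ.src (f s) = vert s) (hrng : ∀ s, vert (next s) = Γ.rng (f s)) (s : S) :
    IsCons (f s) (.inf (InfPath.iterate vert f next hsrc hrng (next s)))
      (.inf (InfPath.iterate vert f next hsrc hrng s)) := by
  refine ⟨(hrng s).symm.trans (hsrc _).symm, congrArg Path.inf (InfPath.ext ?_)⟩
  exact (Stream'.cons_head_tail (fun n => f (next^[n] s))).symm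

/-- Every vertex is the source of some boundary path. -/
theorem exists_isBoundary (Γ : DirectedGraph V E) (v : V) :
    ∃ x : Γ.Path, Γ.IsBoundary x ∧ x.start = v := by
  by_contra hv
  -- otherwise `v` emits an edge whose range has the same defect, and so on forever
  let S := {w : V // ¬ ∃ x : Γ.Path, Γ.IsBoundary x ∧ x.start = w}
  have step : ∀ s : S, ∃ e, Γ.src e = s.1 ∧ ¬ ∃ x : Γ.Path, Γ.IsBoundary x ∧ x.start = Γ.rng e := by
    rintro ⟨w, hw⟩
    have hne : {e | Γ.src e = w} ≠ ∅ := fun h =>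
      hw ⟨.fin (FinPath.vertex Γ w), Or.inl h, rfl⟩
    obtain ⟨e, he⟩ := Set.nonempty_iff_ne_empty.2 hne
    refine ⟨e, he, ?_⟩
    rintro ⟨x, hx, hxe⟩
    obtain ⟨y, hy⟩ := exists_isCons hxe
    exact hw ⟨y, hy.isBoundary_iff.2 hx, hy.start_right.trans he⟩
  choose f hf hf' using step
  exact hv ⟨.inf (InfPath.iterate Subtype.val f (fun s => ⟨Γ.rng (f s), hf' s⟩) hf (fun _ => rfl)
    ⟨v, hv⟩), trivial, hf ⟨v, hv⟩⟩

theorem FinPath.isConcat_vertex (p : Γ.FinPath) :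
    IsConcat p.edges (.fin (FinPath.vertex Γ p.finish)) (.fin p) := by
  have h := p.isConcat_concat (.fin (FinPath.vertex Γ p.finish)) rfl
  have : p.concat (.fin (FinPath.vertex Γ p.finish)) rfl = .fin p :=
    congrArg Path.fin (FinPath.ext rfl (List.append_nil _))
  rwa [this] at h

theorem InfPath.isConcat_take (p : Γ.InfPath) (n : ℕ) :
    ∃ y, IsConcat (p.edges.take n) y (.inf p) := by
  induction n generalizing p with
  | zero => exact ⟨_, rfl⟩
  | succ n ih =>
    obtain ⟨y, hy⟩ := ih ⟨p.edges.tail, fun n => p.chain (n + 1)⟩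
    exact ⟨y, _, hy, p.chain 0, congrArg _ (InfPath.ext (Stream'.cons_head_tail _).symm)⟩

/-- A finite path is determined by its initial segments: the complement of the initial segment `p`
has no edge, since an edge would prolong `p` to a longer initial segment. -/
theorem eq_of_isConcat_imp {p : Γ.FinPath} {x : Γ.Path}
    (h : ∀ k w, (∃ y : Γ.Path, y.start = w ∧ IsConcat k y (.fin p)) ↔
      ∃ y : Γ.Path, y.start = w ∧ IsConcat k y x) : .fin p = x := by
  obtain ⟨y, hy, hk⟩ := (h _ _).1 ⟨_, rfl, p.isConcat_vertex⟩
  rcases exists_isCons_or_eq_vertex y with ⟨e, z, hz⟩ | hv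
  · obtain ⟨z', -, hz'⟩ := (h (p.edges ++ [e]) z.start).2
      ⟨z, rfl, isConcat_append.2 ⟨y, isConcat_singleton.2 hz, hk⟩⟩
    obtain ⟨k, hk, hk'⟩ := p.isConcat_vertex.factor hz' (by simp)
    obtain rfl := hk'.eq_nil_of_vertex
    simp at hk
  · rw [hv, hy] at hk
    exact p.isConcat_vertex.unique hk

/-- A path is determined by its initial segments. -/
theorem eq_of_isConcat_iff {x x' : Γ.Path}
    (h : ∀ k w, (∃ y : Γ.Path, y.start = w ∧ IsConcat k y x) ↔
      ∃ y : Γ.Path, y.start = w ∧ IsConcat k y x') : x = x' := by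
  cases x with
  | fin p => exact eq_of_isConcat_imp h
  | inf p =>
    cases x' with
    | fin q => exact (eq_of_isConcat_imp fun k w => (h k w).symm).symm
    | inf q =>
      refine congrArg _ (InfPath.ext (Stream'.take_theorem _ _ fun n => ?_))
      obtain ⟨y, hy⟩ := p.isConcat_take n
      obtain ⟨z, hz⟩ := q.isConcat_take n
      obtain ⟨y', -, hy'⟩ := (h _ _).1 ⟨y, rfl, hy⟩
      exact (hy'.inj hz (by simp)).1

/-! ### The topology of the graph groupoid -/

/-- In a basic open set, the cylinder around an arrow can be narrowed to any smaller cylinder around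
it. If that cylinder is strictly smaller, no further edges have to be removed. -/
theorem mem_cylDiff_refine {v w : V} {l m l' m' : List E} {F : Finset E} {g : Γ.GraphGroupoid}
    (h : g ∈ Γ.cylDiff v l m F) (h' : g ∈ Γ.cyl w l' m') (hl : l.length ≤ l'.length) :
    ∃ F', g ∈ Γ.cylDiff w l' m' F' ∧ Γ.cylDiff w l' m' F' ⊆ Γ.cylDiff v l m F := by
  obtain ⟨h₁, h₂⟩ := mem_cylDiff.1 h
  rcases hl.eq_or_lt with heq | hlt
  · obtain ⟨k, rfl, rfl, hv⟩ := cyl_factor h₁ h' hl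
    obtain rfl : k = [] := by simpa using heq
    obtain rfl : w = v := hv
    simp only [List.append_nil]
    exact ⟨F, h, subset_rfl⟩
  · refine ⟨∅, by rwa [cylDiff_empty], ?_⟩
    rw [cylDiff_empty]
    intro g' hg'
    refine mem_cylDiff.2 ⟨cyl_subset h₁ h' hl hg', fun e he hge => h₂ e he ?_⟩
    exact cyl_subset hge hg' (by simpa using hlt) h'

theorem isTopologicalBasis_cylDiff :
    IsTopologicalBasis {S : Set Γ.GraphGroupoid | ∃ v l m F, S = Γ.cylDiff v l m F} where
  exists_subset_inter := by
    classical
    have key : ∀ v l m F w l' m' F' (g : Γ.GraphGroupoid), l.length ≤ l'.length →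
        g ∈ Γ.cylDiff v l m F → g ∈ Γ.cylDiff w l' m' F' → ∃ F'', g ∈ Γ.cylDiff w l' m' F'' ∧
        Γ.cylDiff w l' m' F'' ⊆ Γ.cylDiff v l m F ∩ Γ.cylDiff w l' m' F' := by
      intro v l m F w l' m' F' g hl h h'
      obtain ⟨F₁, h₁, h₂⟩ := mem_cylDiff_refine h (cylDiff_subset h') hl
      have hu : Γ.cylDiff w l' m' (F₁ ∪ F') = Γ.cylDiff w l' m' F₁ ∩ Γ.cylDiff w l' m' F' := by
        ext g
        simp only [mem_cylDiff, Finset.mem_union, Set.mem_inter_iff, or_imp, forall_and]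
        tauto
      refine ⟨F₁ ∪ F', ?_⟩
      rw [hu]
      exact ⟨⟨h₁, h'⟩, Set.inter_subset_inter_left _ h₂⟩
    rintro _ ⟨v, l, m, F, rfl⟩ _ ⟨w, l', m', F', rfl⟩ g ⟨h, h'⟩
    rcases le_total l.length l'.length with hl | hl
    · obtain ⟨F'', h₁, h₂⟩ := key _ _ _ _ _ _ _ _ g hl h h'
      exact ⟨_, ⟨_, _, _, _, rfl⟩, h₁, h₂⟩
    · obtain ⟨F'', h₁, h₂⟩ := key _ _ _ _ _ _ _ _ g hl h' h
      exact ⟨_, ⟨_, _, _, _, rfl⟩, h₁, h₂.trans_eq (Set.inter_comm _ _)⟩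
  sUnion_eq := Set.eq_univ_of_forall fun g => by
    obtain ⟨v, l, m, h⟩ := exists_cyl g
    exact ⟨_, ⟨v, l, m, ∅, rfl⟩, by rwa [cylDiff_empty]⟩
  eq_generateFrom := topology_eq

/-- The difference of two nested cylinders is open: passing from the larger one to the smaller one
edge by edge, it is the union of sets `cylDiff` with one edge removed. -/
theorem isOpen_cyl_sdiff (v w : V) (l m k : List E) :
    IsOpen (Γ.cyl v l m \ Γ.cyl w (l ++ k) (m ++ k)) := by
  induction k using List.reverseRecOn generalizing w with
  | nil =>
    simp only [List.append_nil]
    by_cases hvw : v = w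
    · rw [hvw, Set.sdiff_self]
      exact isOpen_empty
    · convert isOpen_cyl (Γ := Γ) v l m using 1
      refine sdiff_eq_left.2 (Set.disjoint_left.2 fun g hg hg' => hvw ?_)
      obtain ⟨k, hk, -, hk'⟩ := cyl_factor hg hg' le_rfl
      obtain rfl : k = [] := by simpa using hk
      exact hk'.symm
  | append_singleton k e ih =>
    simp only [← List.append_assoc]
    by_cases hw : w = Γ.rng e
    · subst hw
      convert (ih (Γ.src e)).union ((isOpen_cyl v l m).inter
        (isOpen_cylDiff (Γ.src e) (l ++ k) (m ++ k) {e})) using 1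
      ext g
      have := fun h => mem_cyl_append (Γ := Γ) (g := g) (v := Γ.src e) (w := Γ.rng e)
        (l := l ++ k) (m := m ++ k) (k := [e]) h rfl
      simp only [Set.mem_sdiff, Set.mem_union, Set.mem_inter_iff, mem_cylDiff,
        Finset.mem_singleton, forall_eq]
      tauto
    · convert isOpen_cyl (Γ := Γ) v l m using 1
      refine sdiff_eq_left.2 (Set.disjoint_left.2 fun g _ hg' => hw ?_)
      obtain ⟨x, rfl, h, -⟩ := hg'
      obtain ⟨z, hz, -⟩ := isConcat_append.1 h
      exact (isConcat_singleton.1 hz).start_left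

theorem isClosed_cyl (v : V) (l m : List E) : IsClosed (Γ.cyl v l m) := by
  rw [← isOpen_compl_iff, isOpen_iff_forall_mem_open]
  intro g hg
  obtain ⟨w, l', m', hg'⟩ := exists_cyl g
  by_cases hd : Disjoint (Γ.cyl w l' m') (Γ.cyl v l m)
  · exact ⟨_, Set.disjoint_left.1 hd, isOpen_cyl _ _ _, hg'⟩
  · obtain ⟨g', h₁, h₂⟩ := Set.not_disjoint_iff.1 hd
    rcases le_total l.length l'.length with hl | hl
    · exact absurd (cyl_subset h₂ h₁ hl hg') hg
    · obtain ⟨k, rfl, rfl, -⟩ := cyl_factor h₁ h₂ hl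
      exact ⟨_, fun x hx => hx.2, isOpen_cyl_sdiff _ _ _ _ _, hg', hg⟩

theorem mem_cyl_append_of_target {v : V} {l m k : List E} {y : Γ.Path} {g : Γ.GraphGroupoid}
    (h : g ∈ Γ.cyl v l m) (hy : IsConcat (l ++ k) y g.target.1) :
    g ∈ Γ.cyl y.start (l ++ k) (m ++ k) := by
  obtain ⟨x, rfl, h1, h2, h3⟩ := h
  obtain ⟨z, hz, hz'⟩ := isConcat_append.1 hy
  obtain rfl := (h1.inj hz' rfl).2
  refine ⟨y, rfl, hy, ?_, isConcat_append.2 ⟨x, hz, h3⟩⟩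
  simp only [List.length_append]
  push_cast
  omega

theorem mem_cyl_append_of_source {v : V} {l m k : List E} {y : Γ.Path} {g : Γ.GraphGroupoid}
    (h : g ∈ Γ.cyl v l m) (hy : IsConcat (m ++ k) y g.source.1) :
    g ∈ Γ.cyl y.start (l ++ k) (m ++ k) := by
  obtain ⟨x, rfl, h1, h2, h3⟩ := h
  obtain ⟨z, hz, hz'⟩ := isConcat_append.1 hy
  obtain rfl := (h3.inj hz' rfl).2
  refine ⟨y, rfl, isConcat_append.2 ⟨x, hz, h1⟩, ?_, hy⟩
  simp only [List.length_append]
  push_cast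
  omega

theorem injOn_source_cyl {v : V} {l m : List E} {g g' : Γ.GraphGroupoid} (h : g ∈ Γ.cyl v l m)
    (h' : g' ∈ Γ.cyl v l m) (he : g.source.1 = g'.source.1) : g = g' := by
  obtain ⟨x, -, h1, h2, h3⟩ := h
  obtain ⟨x', -, h1', h2', h3'⟩ := h'
  rw [← he] at h3'
  obtain rfl := (h3.inj h3' rfl).2
  exact GraphGroupoid.ext_path (h1.unique h1') (h2.trans h2'.symm) he

theorem injOn_target_cyl {v : V} {l m : List E} {g g' : Γ.GraphGroupoid} (h : g ∈ Γ.cyl v l m)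
    (h' : g' ∈ Γ.cyl v l m) (he : g.target.1 = g'.target.1) : g = g' := by
  obtain ⟨x, -, h1, h2, h3⟩ := h
  obtain ⟨x', -, h1', h2', h3'⟩ := h'
  rw [← he] at h1'
  obtain rfl := (h1.inj h1' rfl).2
  exact GraphGroupoid.ext_path he (h2.trans h2'.symm) (h3.unique h3')

/-- Cylinders separate the arrows. -/
theorem eq_of_mem_cyl_iff {g g' : Γ.GraphGroupoid}
    (h : ∀ v l m, g ∈ Γ.cyl v l m ↔ g' ∈ Γ.cyl v l m) : g = g' := by
  obtain ⟨v, l, m, hg⟩ := exists_cyl g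
  have hg' := (h v l m).1 hg
  refine injOn_target_cyl hg hg' (eq_of_isConcat_iff ?_)
  have key : ∀ {a b : Γ.GraphGroupoid}, a ∈ Γ.cyl v l m → b ∈ Γ.cyl v l m →
      (∀ v l m, a ∈ Γ.cyl v l m → b ∈ Γ.cyl v l m) → ∀ k w,
      (∃ y : Γ.Path, y.start = w ∧ IsConcat k y a.target.1) →
      ∃ y : Γ.Path, y.start = w ∧ IsConcat k y b.target.1 := by
    rintro a b ha hb hab k _ ⟨y, rfl, hy⟩
    rcases le_total l.length k.length with hl | hl
    · obtain ⟨x, rfl, h1, h2, h3⟩ := id ha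
      obtain ⟨j, rfl, hj⟩ := h1.factor hy hl
      obtain ⟨z, hz, hz', -⟩ := hab _ _ _ (mem_cyl_append_of_target ha hy)
      exact ⟨z, hz, hz'⟩
    · obtain ⟨x, rfl, h1, h2, h3⟩ := ha
      obtain ⟨x', hx, h1', -, -⟩ := hb
      obtain ⟨j, rfl, hj⟩ := hy.factor h1 hl
      obtain ⟨z, hz, hz'⟩ := isConcat_append.1 h1'
      exact ⟨z, by rw [hz.start, hx, hj.start], hz'⟩
  exact fun k w => ⟨key hg hg' (fun v l m => (h v l m).1) k w,
    key hg' hg (fun v l m => (h v l m).2) k w⟩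

instance : T2Space Γ.GraphGroupoid := by
  refine ⟨fun g g' hne => ?_⟩
  by_contra hcon
  refine hne (eq_of_mem_cyl_iff fun v l m => ?_)
  by_contra h
  rw [not_iff] at h
  refine hcon ?_
  by_cases hg : g ∈ Γ.cyl v l m
  · exact ⟨_, _, isOpen_cyl v l m, (isClosed_cyl v l m).isOpen_compl, hg,
      fun hg' => h.2 hg' hg, disjoint_compl_right⟩
  · exact ⟨_, _, (isClosed_cyl v l m).isOpen_compl, isOpen_cyl v l m, hg, h.1 hg,
      disjoint_compl_left⟩

open Filter Topology in
/-- Since the basic open sets are differences of cylinders, an ultrafilter converges to an arrow that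
lies in the same cylinders. -/
theorem ultrafilter_le_nhds {f : Ultrafilter Γ.GraphGroupoid} {g : Γ.GraphGroupoid}
    (h : ∀ v l m, g ∈ Γ.cyl v l m ↔ Γ.cyl v l m ∈ f) : ↑f ≤ 𝓝 g := by
  intro s hs
  obtain ⟨_, ⟨v, l, m, F, rfl⟩, hg, hsub⟩ := isTopologicalBasis_cylDiff.mem_nhds_iff.1 hs
  obtain ⟨h₁, h₂⟩ := mem_cylDiff.1 hg
  refine mem_of_superset (inter_mem ((h _ _ _).1 h₁) ((biInter_finset_mem F).2
    fun e he => Ultrafilter.compl_mem_iff_notMem.2 (mt (h _ _ _).2 (h₂ e he)))) fun a ha => hsub ?_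
  exact mem_cylDiff.2 ⟨ha.1, fun e he => Set.mem_iInter₂.1 ha.2 e he⟩

theorem mem_cyl_iff_mem_ultrafilter {f : Ultrafilter Γ.GraphGroupoid} {g : Γ.GraphGroupoid}
    {v w : V} {l m l' m' : List E} (h : g ∈ Γ.cyl v l m) (hf : Γ.cyl v l m ∈ f)
    (hl : l'.length ≤ l.length) : g ∈ Γ.cyl w l' m' ↔ Γ.cyl w l' m' ∈ f := by
  constructor
  · exact fun hg => Filter.mem_of_superset hf (cyl_subset hg h hl)
  · intro hf'
    obtain ⟨g', h₁, h₂⟩ := f.neBot.nonempty_of_mem (Filter.inter_mem hf hf')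
    exact cyl_subset h₂ h₁ hl h

/-- A cylinder is compact: an ultrafilter that contains a cylinder selects a chain of smaller and
smaller cylinders, and it converges to the arrow given by the path along this chain. If the chain
stops, then the vertex reached is a sink or an infinite emitter, since otherwise the last cylinder
would be a finite union of smaller ones. -/
theorem isCompact_cyl (v : V) (l m : List E) : IsCompact (Γ.cyl v l m) := by
  rw [isCompact_iff_ultrafilter_le_nhds]
  intro f hf
  rw [Filter.le_principal_iff] at hf
  let S := {p : List E × V // Γ.cyl p.2 (l ++ p.1) (m ++ p.1) ∈ f}
  have hlist : ∀ s : S, Γ.listStart s.1.2 s.1.1 = v := by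
    intro s
    obtain ⟨g, h₁, h₂⟩ := f.neBot.nonempty_of_mem (Filter.inter_mem hf s.2)
    obtain ⟨k, hk, -, hk'⟩ := cyl_factor h₁ h₂ (by simp)
    obtain rfl := List.append_cancel_left hk
    exact hk'
  -- the arrow with tail `x` lies in the cylinder
  have harrow : ∀ (s : S) (x : Γ.Path), Γ.IsBoundary x → x.start = s.1.2 →
      ∃ g ∈ Γ.cyl s.1.2 (l ++ s.1.1) (m ++ s.1.1), IsConcat (l ++ s.1.1) x g.target.1 := by
    rintro s x hx hxs
    obtain ⟨g, y, hy, h1, h2, h3⟩ := f.neBot.nonempty_of_mem s.2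
    obtain ⟨a, ha⟩ := h1.exists_of_start_eq (hxs.trans hy.symm)
    obtain ⟨b, hb⟩ := h3.exists_of_start_eq (hxs.trans hy.symm)
    obtain ⟨g', hg', rfl, -⟩ := exists_mem_cyl hx ha hb
    exact ⟨g', by rwa [← hxs], ha⟩
  -- either the chain of cylinders in `f` continues forever, or it stops at some `s`
  by_cases hstep : ∀ s : S, ∃ e,
      Γ.cyl (Γ.rng e) (l ++ (s.1.1 ++ [e])) (m ++ (s.1.1 ++ [e])) ∈ f
  · choose e he using hstep
    let next : S → S := fun s => ⟨(s.1.1 ++ [e s], Γ.rng (e s)), he s⟩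
    have hsrc : ∀ s : S, Γ.src (e s) = s.1.2 := by
      intro s
      obtain ⟨g, h₁, h₂⟩ := f.neBot.nonempty_of_mem (Filter.inter_mem s.2 (he s))
      rw [← List.append_assoc, ← List.append_assoc] at h₂
      obtain ⟨k, hk, -, hk'⟩ := cyl_factor h₁ h₂ (by simp)
      obtain rfl := List.append_cancel_left hk
      exact hk'
    let path : S → Γ.InfPath :=
      InfPath.iterate (fun s => s.1.2) e next hsrc (fun _ => rfl)
    let s₀ : S := ⟨([], v), by simpa using hf⟩
    have hpath : ∀ n, (next^[n] s₀).1.1.length = n ∧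
        IsConcat (next^[n] s₀).1.1 (.inf (path (next^[n] s₀))) (.inf (path s₀)) := by
      intro n
      induction n with
      | zero => exact ⟨rfl, rfl⟩
      | succ n ih =>
        rw [Function.iterate_succ_apply']
        refine ⟨by simp [next, ih.1], isConcat_append.2 ⟨_, isConcat_singleton.2 ?_, ih.2⟩⟩
        exact InfPath.isCons_iterate (fun s : S => s.1.2) e next hsrc (fun _ => rfl) _
    obtain ⟨g, hg, hgx⟩ := harrow s₀ (.inf (path s₀)) trivial (hsrc s₀)
    have hg : g ∈ Γ.cyl v l m := by simpa [s₀] using hg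
    have hgx : IsConcat l (.inf (path s₀)) g.target.1 := by simpa [s₀] using hgx
    refine ⟨g, hg, ultrafilter_le_nhds fun w l' m' => ?_⟩
    obtain ⟨h₁, h₂⟩ := hpath l'.length
    refine mem_cyl_iff_mem_ultrafilter (v := (next^[l'.length] s₀).1.2) ?_
      (next^[l'.length] s₀).2 (by simp [h₁])
    have := mem_cyl_append_of_target hg (isConcat_append.2 ⟨_, h₂, hgx⟩)
    rwa [show Path.start (.inf (path (next^[l'.length] s₀))) = (next^[l'.length] s₀).1.2 from
      hsrc _] at this
  · push Not at hstep
    obtain ⟨s, hs⟩ := hstep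
    obtain ⟨⟨k, w⟩, hk⟩ := s
    have hbd : Γ.IsBoundary (.fin (FinPath.vertex Γ w)) := by
      by_contra hcon
      have hcon : ¬ ({e | Γ.src e = w} = ∅ ∨ {e | Γ.src e = w}.Infinite) := hcon
      rw [not_or, Set.not_infinite] at hcon
      have : Γ.cyl w (l ++ k) (m ++ k) ⊆ ⋃ e ∈ {e | Γ.src e = w},
          Γ.cyl (Γ.rng e) (l ++ (k ++ [e])) (m ++ (k ++ [e])) := by
        intro g hg
        obtain ⟨x, rfl, h1, h2, h3⟩ := id hg
        rcases exists_isCons_or_eq_vertex x with ⟨e, y, hy⟩ | hx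
        · refine Set.mem_iUnion₂.2 ⟨e, hy.start_right.symm, ?_⟩
          rw [← hy.start_left, ← List.append_assoc, ← List.append_assoc]
          exact mem_cyl_append_of_target hg (isConcat_append.2 ⟨x, isConcat_singleton.2 hy, h1⟩)
        · have hb := h1.isBoundary_iff.1 g.target.2
          rw [hx] at hb
          rcases hb with hb | hb
          · exact absurd hb hcon.1
          · exact absurd hcon.2 hb
      obtain ⟨e, -, he⟩ := (Ultrafilter.finite_biUnion_mem_iff hcon.2).1
        (Filter.mem_of_superset hk this)
      exact hs e he
    obtain ⟨g, hg, hgx⟩ := harrow ⟨(k, w), hk⟩ _ hbd rfl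
    refine ⟨g, mem_cyl_append hg (hlist ⟨(k, w), hk⟩), ultrafilter_le_nhds fun w' l' m' => ?_⟩
    rcases le_or_gt l'.length (l ++ k).length with hl | hl
    · exact mem_cyl_iff_mem_ultrafilter hg hk hl
    · constructor
      · rintro ⟨y, rfl, h1, -, -⟩
        obtain ⟨j, rfl, hj⟩ := hgx.factor h1 hl.le
        obtain rfl := hj.eq_nil_of_vertex
        simp at hl
      · intro hf'
        obtain ⟨g', h₁, h₂⟩ := f.neBot.nonempty_of_mem (Filter.inter_mem hk hf')
        obtain ⟨j, rfl, rfl, hj⟩ := cyl_factor h₁ h₂ hl.le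
        cases j with
        | nil => simp at hl
        | cons e j =>
          refine absurd (Filter.mem_of_superset hf' fun a ha => ?_) (hs e)
          obtain ⟨x, rfl, h1, -⟩ := id h₂
          obtain ⟨z, hz, -⟩ := isConcat_append.1 h1
          obtain ⟨z', hz', hz⟩ := hz
          refine mem_cyl_append (k := j) (w := x.start) ?_
            (hz'.start.symm.trans hz.start_left)
          simpa using ha

theorem isCompact_cylDiff (v : V) (l m : List E) (F : Finset E) :
    IsCompact (Γ.cylDiff v l m F) :=
  (isCompact_cyl v l m).diff (isOpen_biUnion fun _ _ => isOpen_cyl _ _ _)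

open ArrowGroupoid

/-! ### The graph groupoid as a topological groupoid -/

theorem src_eq_rng_iff {g g' : Γ.GraphGroupoid} : ArrowGroupoid.src g = ArrowGroupoid.rng g' ↔ g.source = g'.target :=
  ⟨fun h => congrArg GraphGroupoid.source h, fun h => GraphGroupoid.ext h rfl h⟩

theorem src_eq_src_iff {g g' : Γ.GraphGroupoid} : ArrowGroupoid.src g = ArrowGroupoid.src g' ↔ g.source = g'.source :=
  ⟨fun h => by have := congrArg GraphGroupoid.source h; exact this, fun h => GraphGroupoid.ext h rfl h⟩

theorem rng_eq_rng_iff {g g' : Γ.GraphGroupoid} : ArrowGroupoid.rng g = ArrowGroupoid.rng g' ↔ g.target = g'.target :=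
  ⟨fun h => congrArg GraphGroupoid.source h, fun h => GraphGroupoid.ext h rfl h⟩

theorem inv_mem_cyl {g : Γ.GraphGroupoid} {v : V} {l m : List E} :
    inv g ∈ Γ.cyl v l m ↔ g ∈ Γ.cyl v m l := by
  have key : ∀ (g : Γ.GraphGroupoid) l m, g ∈ Γ.cyl v m l → inv g ∈ Γ.cyl v l m := by
    rintro g l m ⟨x, hx, h1, h2, h3⟩
    refine ⟨x, hx, h3, ?_, h1⟩
    change -g.deg = _
    omega
  exact ⟨fun h => by simpa only [ArrowGroupoid.inv_inv] using key _ _ _ h, key _ _ _⟩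

theorem inv_mem_cylDiff {g : Γ.GraphGroupoid} {v : V} {l m : List E} {F : Finset E} :
    inv g ∈ Γ.cylDiff v l m F ↔ g ∈ Γ.cylDiff v m l F := by
  simp only [mem_cylDiff, inv_mem_cyl]

theorem continuous_inv : Continuous (inv : Γ.GraphGroupoid → Γ.GraphGroupoid) := by
  refine isTopologicalBasis_cylDiff.continuous_iff.2 ?_
  rintro _ ⟨v, l, m, F, rfl⟩
  convert isOpen_cylDiff v m l F using 1
  ext g
  exact inv_mem_cylDiff

theorem comp_mem_cyl {g g' : Γ.GraphGroupoid} {v : V} {l k m : List E} (hg : g ∈ Γ.cyl v l k)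
    (hg' : g' ∈ Γ.cyl v k m) (h : ArrowGroupoid.src g = ArrowGroupoid.rng g') : comp g g' h ∈ Γ.cyl v l m := by
  obtain ⟨x, hx, h1, h2, h3⟩ := hg
  obtain ⟨y, -, h1', h2', h3'⟩ := hg'
  rw [← src_eq_rng_iff.1 h] at h1'
  obtain rfl := (h3.inj h1' rfl).2
  refine ⟨x, hx, h1, ?_, h3'⟩
  change g.deg + g'.deg = _
  omega

/-- Composable arrows can be written with the same middle segment, and so that their composite
lies in a given cylinder with shorter initial segments. -/
theorem exists_cyl_of_comp {g g' : Γ.GraphGroupoid} (h : ArrowGroupoid.src g = ArrowGroupoid.rng g') (v : V) (l m : List E)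
    (hc : comp g g' h ∈ Γ.cyl v l m) :
    ∃ w a b c, l.length ≤ a.length ∧ g ∈ Γ.cyl w a b ∧ g' ∈ Γ.cyl w b c := by
  have h' := src_eq_rng_iff.1 h
  obtain ⟨w, a, b, c, hg, hg'⟩ : ∃ w a b c, g ∈ Γ.cyl w a b ∧ g' ∈ Γ.cyl w b c := by
    obtain ⟨w, a, b, hg⟩ := exists_cyl g
    obtain ⟨w', b', c, hg'⟩ := exists_cyl g'
    obtain ⟨x, hx, h1, h2, h3⟩ := id hg
    obtain ⟨y, hy, h1', h2', h3'⟩ := id hg'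
    rcases le_total b.length b'.length with hl | hl
    · obtain ⟨k, rfl, hk⟩ := h3.factor (h' ▸ h1') hl
      exact ⟨_, _, _, _, mem_cyl_append_of_source hg (h' ▸ h1'), hy ▸ hg'⟩
    · obtain ⟨k, rfl, hk⟩ := h1'.factor (h' ▸ h3) hl
      exact ⟨_, _, _, _, hx ▸ hg, mem_cyl_append_of_target hg' (h' ▸ h3)⟩
  rcases le_total l.length a.length with hl | hl
  · exact ⟨w, a, b, c, hl, hg, hg'⟩
  · obtain ⟨z, -, hz, -, -⟩ := hc
    obtain ⟨x, hx, h1, h2, h3⟩ := id hg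
    obtain ⟨k, rfl, hk⟩ := h1.factor hz hl
    have hg₂ := mem_cyl_append_of_target hg hz
    refine ⟨_, _, _, _, le_rfl, hg₂, mem_cyl_append_of_target hg' ?_⟩
    obtain ⟨t, ht, -, -, h4⟩ := hg₂
    rw [← h']
    exact isConcat_append.2 ⟨x, hk, h3⟩

/-- After narrowing to longer segments, `Z(γ, δ, F)` contains the products of arrows in `Z(γ, β, F)`
and `Z(β, δ)`. -/
theorem continuous_comp : Continuous
    (fun p : {p : Γ.GraphGroupoid × Γ.GraphGroupoid // ArrowGroupoid.src p.1 = ArrowGroupoid.rng p.2} =>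
      comp p.1.1 p.1.2 p.2) := by
  refine isTopologicalBasis_cylDiff.continuous_iff.2 ?_
  rintro _ ⟨v, l, m, F, rfl⟩
  rw [isOpen_iff_forall_mem_open]
  rintro ⟨⟨g, g'⟩, h⟩ hmem
  obtain ⟨w, a, b, c, hl, hg, hg'⟩ := exists_cyl_of_comp h v l m (cylDiff_subset hmem)
  obtain ⟨F', hF', hsub⟩ := mem_cylDiff_refine hmem (comp_mem_cyl hg hg' h) hl
  refine ⟨Subtype.val ⁻¹' (Γ.cylDiff w a b F' ×ˢ Γ.cyl w b c), ?_,
    ((isOpen_cylDiff _ _ _ _).prod (isOpen_cyl _ _ _)).preimage continuous_subtype_val,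
    mem_cylDiff.2 ⟨hg, fun e he hge => ?_⟩, hg'⟩
  · rintro ⟨⟨γ, γ'⟩, hγγ⟩ ⟨hγ, hγ'⟩
    obtain ⟨h₁, h₂⟩ := mem_cylDiff.1 hγ
    refine hsub (mem_cylDiff.2 ⟨comp_mem_cyl h₁ hγ' hγγ, fun e he hge => h₂ e he ?_⟩)
    obtain ⟨y, hy, h1, -, -⟩ := hge
    rw [← hy]
    exact mem_cyl_append_of_target h₁ h1
  · refine (mem_cylDiff.1 hF').2 e he ?_
    obtain ⟨y, hy, h1, -, -⟩ := hge
    rw [← hy]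
    exact mem_cyl_append_of_target (comp_mem_cyl hg hg' h) h1

instance : IsTopologicalGroupoid Γ.GraphGroupoid := ⟨continuous_inv, continuous_comp⟩

theorem src_image_cylDiff {v : V} {l m : List E} {F : Finset E}
    (hne : (Γ.cyl v l m).Nonempty) : ArrowGroupoid.src '' Γ.cylDiff v l m F = Γ.cylDiff v m m F := by
  ext h
  constructor
  · rintro ⟨g, hg, rfl⟩
    obtain ⟨h₁, h₂⟩ := mem_cylDiff.1 hg
    refine mem_cylDiff.2 ⟨?_, fun e he ⟨y, hy, _, _, h3⟩ => h₂ e he ?_⟩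
    · obtain ⟨x, hx, h1, h2, h3⟩ := h₁
      exact ⟨x, hx, h3, (sub_self _).symm, h3⟩
    · rw [← hy]
      exact mem_cyl_append_of_source h₁ h3
  · intro hh
    obtain ⟨h₁, h₂⟩ := mem_cylDiff.1 hh
    obtain ⟨x, hx, h1, h2, h3⟩ := id h₁
    obtain ⟨g₀, x₀, hx₀, h0, -, -⟩ := hne
    obtain ⟨a, ha⟩ := h0.exists_of_start_eq (hx.trans hx₀.symm)
    obtain ⟨g, hg, -, hgs⟩ := exists_mem_cyl (h1.isBoundary_iff.1 h.target.2) ha h3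
    rw [hx] at hg
    refine ⟨g, mem_cylDiff.2 ⟨hg, fun e he ⟨y, hy, _, _, h4⟩ => h₂ e he ?_⟩, ?_⟩
    · rw [← hy]
      exact mem_cyl_append_of_source h₁ (hgs ▸ h4)
    · refine GraphGroupoid.ext_path (hgs.trans ?_) (h2.trans (sub_self _)).symm hgs
      exact h3.unique h1

theorem isOpenMap_src : IsOpenMap (ArrowGroupoid.src : Γ.GraphGroupoid → Γ.GraphGroupoid) := by
  refine isTopologicalBasis_cylDiff.isOpenMap_iff.2 ?_
  rintro _ ⟨v, l, m, F, rfl⟩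
  by_cases hne : (Γ.cyl v l m).Nonempty
  · rw [src_image_cylDiff hne]
    exact isOpen_cylDiff v m m F
  · rw [cylDiff, Set.not_nonempty_iff_eq_empty.1 hne, Set.empty_sdiff, Set.image_empty]
    exact isOpen_empty

theorem injOn_src_cylDiff (v : V) (l m : List E) (F : Finset E) :
    Set.InjOn ArrowGroupoid.src (Γ.cylDiff v l m F) := fun _ hg _ hg' h =>
  injOn_source_cyl (cylDiff_subset hg) (cylDiff_subset hg')
    (congrArg Subtype.val (src_eq_src_iff.1 h))

theorem injOn_rng_cylDiff (v : V) (l m : List E) (F : Finset E) :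
    Set.InjOn ArrowGroupoid.rng (Γ.cylDiff v l m F) := fun _ hg _ hg' h =>
  injOn_target_cyl (cylDiff_subset hg) (cylDiff_subset hg')
    (congrArg Subtype.val (rng_eq_rng_iff.1 h))

end DirectedGraph

namespace ArrowGroupoid

open TopologicalSpace

/-! ### A criterion for ample groupoids -/

section Criterion

variable {G : Type u} [TopologicalSpace G] [ArrowGroupoid G] [IsTopologicalGroupoid G]

theorem continuous_src : Continuous (src : G → G) := by
  have h : Continuous fun g : G =>
      (⟨(inv g, g), src_inv g⟩ : {p : G × G // src p.1 = rng p.2}) :=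
    (IsTopologicalGroupoid.continuous_inv.prodMk continuous_id).subtype_mk _
  refine (IsTopologicalGroupoid.continuous_comp.comp h).congr fun g => ?_
  exact inv_comp g (src_inv g)

theorem continuous_rng : Continuous (rng : G → G) := by
  have : (rng : G → G) = src ∘ inv := funext fun g => (src_inv g).symm
  rw [this]
  exact continuous_src.comp IsTopologicalGroupoid.continuous_inv

theorem isOpenMap_rng (h : IsOpenMap (src : G → G)) : IsOpenMap (rng : G → G) := by
  have : (rng : G → G) = src ∘ inv := funext fun g => (src_inv g).symm
  rw [this]
  exact h.comp (Homeomorph.mk ⟨inv, inv, inv_inv, inv_inv⟩ IsTopologicalGroupoid.continuous_inv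
    IsTopologicalGroupoid.continuous_inv : G ≃ₜ G).isOpenMap

/-- If the source map is open as a map to the groupoid, then every open set on which source and
range are injective is an open bisection. -/
theorem isOpenBisection_of_injOn (hsrc : IsOpenMap (src : G → G)) {U : Set G} (hU : IsOpen U)
    (hs : Set.InjOn src U) (hr : Set.InjOn rng U) : IsOpenBisection U := by
  refine ⟨hU, ?_, ?_⟩
  · refine Topology.IsOpenEmbedding.of_continuous_injective_isOpenMap
      ((continuous_src.subtype_mk _).comp continuous_subtype_val) ?_
      ((hsrc.subtype_mk _).comp hU.isOpenMap_subtype_val)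
    exact fun a b h => Subtype.ext (hs a.2 b.2 (srcUnit_eq.1 h))
  · refine Topology.IsOpenEmbedding.of_continuous_injective_isOpenMap
      ((continuous_rng.subtype_mk _).comp continuous_subtype_val) ?_
      (((isOpenMap_rng hsrc).subtype_mk _).comp hU.isOpenMap_subtype_val)
    exact fun a b h => Subtype.ext (hr a.2 b.2 (rngUnit_eq.1 h))

/-- A Hausdorff topological groupoid with open source map is ample if it has a base of compact open
sets on which source and range are injective. -/
theorem isAmpleGroupoid_of_basis [T2Space G] (hsrc : IsOpenMap (src : G → G))
    {B : Set (Set G)} (hB : IsTopologicalBasis B)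
    (hc : ∀ U ∈ B, IsCompact U ∧ Set.InjOn src U ∧ Set.InjOn rng U) : IsAmpleGroupoid G := by
  have hbis : ∀ U ∈ B, IsOpenBisection U := fun U hU =>
    isOpenBisection_of_injOn hsrc (hB.isOpen hU) (hc U hU).2.1 (hc U hU).2.2
  have hloc : LocallyCompactSpace G := by
    refine ⟨fun g n hn => ?_⟩
    obtain ⟨U, hU, hg, hUn⟩ := hB.mem_nhds_iff.1 hn
    exact ⟨U, (hB.isOpen hU).mem_nhds hg, hUn, (hc U hU).1⟩
  have hcl : IsClosed (unitSpace G) := by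
    have : unitSpace G = {g | src g = g} := by
      ext g
      exact ⟨by rintro ⟨a, rfl⟩; exact src_src a, fun h => ⟨g, h⟩⟩
    rw [this]
    exact isClosed_eq continuous_src continuous_id
  exact
    { locallyCompact_unitSpace := hcl.isClosedEmbedding_subtypeVal.locallyCompactSpace
      t2_unitSpace := inferInstance
      isLocalHomeomorph_src := by
        refine isLocalHomeomorph_iff_isOpenEmbedding_restrict.2 fun g => ?_
        obtain ⟨U, hU, hg, -⟩ := hB.exists_subset_of_mem_open (Set.mem_univ g) isOpen_univ
        exact ⟨U, (hB.isOpen hU).mem_nhds hg, (hbis U hU).src_isOpenEmbedding⟩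
      isTopologicalBasis := by
        refine isTopologicalBasis_of_isOpen_of_nhds (fun U hU => hU.2.isOpen) fun g U hg hU => ?_
        obtain ⟨W, hW, hgW, hWU⟩ := hB.exists_subset_of_mem_open hg hU
        exact ⟨W, ⟨(hc W hW).1, hbis W hW⟩, hgW, hWU⟩ }

end Criterion

section OpenSubgroupoid

variable {G : Type u} [TopologicalSpace G] [ArrowGroupoid G] (S : Subgroupoid G)

instance [IsTopologicalGroupoid G] : IsTopologicalGroupoid S.carrier where
  continuous_inv :=
    (IsTopologicalGroupoid.continuous_inv.comp continuous_subtype_val).subtype_mk _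
  continuous_comp := by
    have h : Continuous fun p : {p : S.carrier × S.carrier // src p.1 = rng p.2} =>
        (⟨(p.1.1.1, p.1.2.1), congrArg Subtype.val p.2⟩ : {p : G × G // src p.1 = rng p.2}) :=
      ((continuous_subtype_val.comp (continuous_fst.comp continuous_subtype_val)).prodMk
        (continuous_subtype_val.comp (continuous_snd.comp continuous_subtype_val))).subtype_mk _
    exact (IsTopologicalGroupoid.continuous_comp.comp h).subtype_mk _

variable {S}

theorem Subgroupoid.isOpenMap_src (hS : IsOpen S.carrier) (h : IsOpenMap (src : G → G)) :
    IsOpenMap (src : S.carrier → S.carrier) := by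
  intro U hU
  rw [hS.isOpenEmbedding_subtypeVal.isOpen_iff_image_isOpen]
  have : Subtype.val '' (src '' U) = (src '' (Subtype.val '' U) : Set G) := by
    rw [Set.image_image, Set.image_image]
    rfl
  rw [this]
  exact h _ (hS.isOpenMap_subtype_val _ hU)

/-- The restrictions to an open subgroupoid of the groupoids in `isAmpleGroupoid_of_basis` are
ample. -/
theorem Subgroupoid.isAmpleGroupoid_of_basis [IsTopologicalGroupoid G] [T2Space G]
    (hsrc : IsOpenMap (src : G → G)) {B : Set (Set G)} (hB : IsTopologicalBasis B)
    (hc : ∀ U ∈ B, IsCompact U ∧ Set.InjOn src U ∧ Set.InjOn rng U) (hS : IsOpen S.carrier) :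
    IsAmpleGroupoid S.carrier := by
  refine ArrowGroupoid.isAmpleGroupoid_of_basis (S.isOpenMap_src hS hsrc)
    (B := {U | ∃ W ∈ B, W ⊆ S.carrier ∧ U = Subtype.val ⁻¹' W}) ?_ ?_
  · refine isTopologicalBasis_of_isOpen_of_nhds ?_ fun g U hg hU => ?_
    · rintro _ ⟨W, hW, -, rfl⟩
      exact (hB.isOpen hW).preimage continuous_subtype_val
    · obtain ⟨W, hW, hgW, hWU⟩ := hB.exists_subset_of_mem_open
        (Set.mem_image_of_mem Subtype.val hg) (hS.isOpenMap_subtype_val _ hU)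
      refine ⟨_, ⟨W, hW, hWU.trans (Subtype.coe_image_subset _ _), rfl⟩, hgW, ?_⟩
      intro a ha
      obtain ⟨b, hb, hab⟩ := hWU ha
      rwa [← Subtype.ext hab]
  · rintro _ ⟨W, hW, hWS, rfl⟩
    obtain ⟨h1, h2, h3⟩ := hc W hW
    refine ⟨?_, ?_, ?_⟩
    · rw [Subtype.isCompact_iff, Subtype.image_preimage_coe, Set.inter_eq_right.2 hWS]
      exact h1
    · exact fun a ha b hb h => Subtype.ext (h2 ha hb (congrArg Subtype.val h))
    · exact fun a ha b hb h => Subtype.ext (h3 ha hb (congrArg Subtype.val h))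

end OpenSubgroupoid

end ArrowGroupoid

namespace DirectedGraph

variable {V : Type u} {E : Type v} {Γ : DirectedGraph V E}

open TopologicalSpace ArrowGroupoid

/-! ### The graph groupoid and its restrictions are ample -/

instance : IsAmpleGroupoid Γ.GraphGroupoid := by
  refine isAmpleGroupoid_of_basis isOpenMap_src isTopologicalBasis_cylDiff ?_
  rintro _ ⟨v, l, m, F, rfl⟩
  exact ⟨isCompact_cylDiff _ _ _ _, injOn_src_cylDiff _ _ _ _, injOn_rng_cylDiff _ _ _ _⟩

theorem isOpenBisection_cyl (v : V) (l m : List E) : IsOpenBisection (Γ.cyl v l m) := by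
  rw [← cylDiff_empty]
  exact isOpenBisection_of_injOn isOpenMap_src (isOpen_cylDiff _ _ _ _)
    (injOn_src_cylDiff _ _ _ _) (injOn_rng_cylDiff _ _ _ _)

theorem cyl_subset_restrictSet {H : Set V} {v : V} {l m : List E} (h : Γ.listStart v l ∈ H)
    (h' : Γ.listStart v m ∈ H) : Γ.cyl v l m ⊆ Γ.restrictSet H := by
  intro g hg
  rw [mem_restrictSet, start_target_of_mem_cyl hg, start_source_of_mem_cyl hg]
  exact ⟨h, h'⟩

theorem isClopen_restrictSet (H : Set V) : IsClopen (Γ.restrictSet H) := by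
  constructor
  · rw [← isOpen_compl_iff, isOpen_iff_forall_mem_open]
    intro g hg
    obtain ⟨v, l, m, h⟩ := exists_cyl g
    refine ⟨_, fun g' hg' hH => hg ?_, isOpen_cyl v l m, h⟩
    rw [mem_restrictSet, start_target_of_mem_cyl hg', start_source_of_mem_cyl hg'] at hH
    rw [mem_restrictSet, start_target_of_mem_cyl h, start_source_of_mem_cyl h]
    exact hH
  · rw [isOpen_iff_forall_mem_open]
    intro g hg
    obtain ⟨v, l, m, h⟩ := exists_cyl g
    rw [mem_restrictSet, start_target_of_mem_cyl h, start_source_of_mem_cyl h] at hg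
    exact ⟨_, cyl_subset_restrictSet hg.1 hg.2, isOpen_cyl v l m, h⟩

instance isAmpleGroupoid_restrict (H : Set V) : IsAmpleGroupoid (Γ.restrict H).carrier := by
  refine Subgroupoid.isAmpleGroupoid_of_basis isOpenMap_src isTopologicalBasis_cylDiff ?_
    (isClopen_restrictSet H).isOpen
  rintro _ ⟨v, l, m, F, rfl⟩
  exact ⟨isCompact_cylDiff _ _ _ _, injOn_src_cylDiff _ _ _ _, injOn_rng_cylDiff _ _ _ _⟩

variable {K : Type w} [Field K]

/-! ### Leavitt path algebras: universal property and spanning monomials -/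

section Lift

variable {A : Type u'} [NonUnitalRing A] [Module K A] [IsScalarTower K A A] [SMulCommClass K A A]

/-- The homomorphism from the free algebra given by the images of the generators. -/
noncomputable def freeLift (f : LeavittGen V E → A) : LeavittFree V E K →ₙₐ[K] A :=
  MonoidAlgebra.liftMagma K (FreeSemigroup.lift f)

theorem freeLift_freeGen (f : LeavittGen V E → A) (x : LeavittGen V E) :
    freeLift f (freeGen K x) = f x := by
  simp [freeLift, freeGen]

/-- The homomorphism from the Leavitt path algebra given by images of the generators that satisfy
the defining relations. -/
noncomputable def leavittLift (f : LeavittGen V E → A)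
    (hf : ∀ x y, Γ.LeavittRel K x y → freeLift f x = freeLift f y) :
    Γ.LeavittPathAlgebra K →ₙₐ[K] A :=
  let c : RingCon (LeavittFree V E K) :=
    { r := fun x y => freeLift f x = freeLift f y
      iseqv := ⟨fun _ => rfl, Eq.symm, Eq.trans⟩
      mul' := fun h h' => by rw [map_mul, map_mul, h, h']
      add' := fun h h' => by rw [map_add, map_add, h, h'] }
  have hc : ∀ x y, Γ.leavittCon K x y → freeLift f x = freeLift f y := fun x y h =>
    h c ⟨hf, fun k x y h => (map_smul (freeLift f) k x).trans
      ((congrArg (k • ·) h).trans (map_smul (freeLift f) k y).symm)⟩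
  { toFun := Quotient.lift (freeLift f) hc
    map_smul' := fun k x => by
      obtain ⟨x, rfl⟩ := Γ.leavittMk_surjective K x
      exact map_smul (freeLift f) k x
    map_zero' := map_zero (freeLift f)
    map_add' := fun x y => by
      obtain ⟨x, rfl⟩ := Γ.leavittMk_surjective K x
      obtain ⟨y, rfl⟩ := Γ.leavittMk_surjective K y
      exact map_add (freeLift f) x y
    map_mul' := fun x y => by
      obtain ⟨x, rfl⟩ := Γ.leavittMk_surjective K x
      obtain ⟨y, rfl⟩ := Γ.leavittMk_surjective K y
      exact map_mul (freeLift f) x y }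

theorem leavittLift_leavittMk (f : LeavittGen V E → A)
    (hf : ∀ x y, Γ.LeavittRel K x y → freeLift f x = freeLift f y) (x : LeavittFree V E K) :
    leavittLift f hf (Γ.leavittMk K x) = freeLift f x := rfl

end Lift

theorem leavittMk_eq {x y : LeavittFree V E K} (h : Γ.LeavittRel K x y) :
    Γ.leavittMk K x = Γ.leavittMk K y :=
  Quotient.sound fun _ hc => hc.1 x y h

theorem leavittMk_mul (x y : LeavittFree V E K) :
    Γ.leavittMk K (x * y) = Γ.leavittMk K x * Γ.leavittMk K y := rfl

/-- The class of an element of the free algebra, as a linear map. -/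
noncomputable def leavittMkLinear (Γ : DirectedGraph V E) (K : Type w) [Field K] :
    LeavittFree V E K →ₗ[K] Γ.LeavittPathAlgebra K where
  toFun := Γ.leavittMk K
  map_add' _ _ := rfl
  map_smul' _ _ := rfl

variable (Γ K) in
/-- The edge `e` as an element of the Leavitt path algebra. -/
noncomputable def leavittEdge (e : E) : Γ.LeavittPathAlgebra K :=
  Γ.leavittMk K (freeGen K (.edge e))

variable (Γ K) in
/-- The ghost edge `e*` as an element of the Leavitt path algebra. -/
noncomputable def leavittGhost (e : E) : Γ.LeavittPathAlgebra K :=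
  Γ.leavittMk K (freeGen K (.ghost e))

theorem vertex_mul_self (v : V) :
    Γ.leavittVertex K v * Γ.leavittVertex K v = Γ.leavittVertex K v :=
  leavittMk_eq (.vertex_mul_self v)

theorem vertex_mul_ne {v w : V} (h : v ≠ w) :
    Γ.leavittVertex K v * Γ.leavittVertex K w = 0 :=
  leavittMk_eq (.vertex_mul_ne v w h)

theorem src_mul_edge (e : E) :
    Γ.leavittVertex K (Γ.src e) * Γ.leavittEdge K e = Γ.leavittEdge K e :=
  leavittMk_eq (.src_mul_edge e)

theorem edge_mul_rng (e : E) :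
    Γ.leavittEdge K e * Γ.leavittVertex K (Γ.rng e) = Γ.leavittEdge K e :=
  leavittMk_eq (.edge_mul_rng e)

theorem rng_mul_ghost (e : E) :
    Γ.leavittVertex K (Γ.rng e) * Γ.leavittGhost K e = Γ.leavittGhost K e :=
  leavittMk_eq (.rng_mul_ghost e)

theorem ghost_mul_src (e : E) :
    Γ.leavittGhost K e * Γ.leavittVertex K (Γ.src e) = Γ.leavittGhost K e :=
  leavittMk_eq (.ghost_mul_src e)

theorem ghost_mul_self (e : E) :
    Γ.leavittGhost K e * Γ.leavittEdge K e = Γ.leavittVertex K (Γ.rng e) :=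
  leavittMk_eq (.ghost_mul_self e)

theorem ghost_mul_ne {e f : E} (h : e ≠ f) : Γ.leavittGhost K e * Γ.leavittEdge K f = 0 :=
  leavittMk_eq (.ghost_mul_ne e f h)

theorem vertex_eq_sum (v : V) (hne : {e | Γ.src e = v}.Nonempty)
    (hfin : {e | Γ.src e = v}.Finite) : Γ.leavittVertex K v =
      ∑ e ∈ hfin.toFinset, Γ.leavittEdge K e * Γ.leavittGhost K e := by
  refine (leavittMk_eq (.regular v hne hfin)).trans ?_
  exact map_sum (Γ.leavittMkLinear K) _ _

variable (Γ K) in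
/-- The element `β*` of the Leavitt path algebra, where `β` is the path with the edges `m` that
ends at `v`; it is zero if there is no such path. -/
noncomputable def ghostMonomial (v : V) : List E → Γ.LeavittPathAlgebra K
  | [] => Γ.leavittVertex K v
  | e :: m => ghostMonomial v m * Γ.leavittGhost K e

variable (Γ K) in
/-- The element `α β*` of the Leavitt path algebra, where `α` and `β` are the paths with the edges
`l` and `m` that end at `v`; it is zero if there are no such paths. -/
noncomputable def leavittMonomial (v : V) (l m : List E) : Γ.LeavittPathAlgebra K :=
  match l with
  | [] => Γ.ghostMonomial K v m
  | e :: l => Γ.leavittEdge K e * leavittMonomial v l m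

theorem vertex_mul_ghostMonomial (v : V) (m : List E) :
    Γ.leavittVertex K v * Γ.ghostMonomial K v m = Γ.ghostMonomial K v m := by
  induction m with
  | nil => exact vertex_mul_self v
  | cons e m ih => rw [ghostMonomial, ← mul_assoc, ih]

theorem listStart_mul_monomial (v : V) (l m : List E) :
    Γ.leavittVertex K (Γ.listStart v l) * Γ.leavittMonomial K v l m =
      Γ.leavittMonomial K v l m := by
  cases l with
  | nil => exact vertex_mul_ghostMonomial v m
  | cons e l => rw [listStart, leavittMonomial, ← mul_assoc, src_mul_edge]

theorem vertex_mul_monomial_ne {u v : V} {l m : List E} (h : u ≠ Γ.listStart v l) :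
    Γ.leavittVertex K u * Γ.leavittMonomial K v l m = 0 := by
  rw [← listStart_mul_monomial, ← mul_assoc, vertex_mul_ne h, zero_mul]

theorem monomial_mul_listStart (v : V) (l m : List E) :
    Γ.leavittMonomial K v l m * Γ.leavittVertex K (Γ.listStart v m) =
      Γ.leavittMonomial K v l m := by
  induction l with
  | nil =>
    cases m with
    | nil => exact vertex_mul_self v
    | cons e m => rw [listStart, leavittMonomial, ghostMonomial, mul_assoc, ghost_mul_src]
  | cons e l ih => rw [leavittMonomial, mul_assoc, ih]

theorem monomial_mul_vertex_ne {u v : V} {l m : List E} (h : Γ.listStart v m ≠ u) :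
    Γ.leavittMonomial K v l m * Γ.leavittVertex K u = 0 := by
  rw [← monomial_mul_listStart, mul_assoc, vertex_mul_ne h, mul_zero]

theorem ghost_mul_monomial_cons (e : E) (v : V) (l m : List E) :
    Γ.leavittGhost K e * Γ.leavittMonomial K v (e :: l) m =
      Γ.leavittVertex K (Γ.rng e) * Γ.leavittMonomial K v l m := by
  rw [leavittMonomial, ← mul_assoc, ghost_mul_self]

theorem ghost_mul_monomial_cons_ne {e f : E} (h : e ≠ f) (v : V) (l m : List E) :
    Γ.leavittGhost K e * Γ.leavittMonomial K v (f :: l) m = 0 := by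
  rw [leavittMonomial, ← mul_assoc, ghost_mul_ne h, zero_mul]

theorem ghost_mul_monomial_nil (e : E) (m : List E) :
    Γ.leavittGhost K e * Γ.leavittMonomial K (Γ.src e) [] m =
      Γ.leavittMonomial K (Γ.rng e) [] (m ++ [e]) := by
  change _ * Γ.ghostMonomial K _ m = Γ.ghostMonomial K _ _
  induction m with
  | nil => exact (ghost_mul_src e).trans (rng_mul_ghost e).symm
  | cons f m ih => rw [ghostMonomial, ← mul_assoc, ih]; rfl

theorem ghost_mul_monomial_nil_ne {e : E} {v : V} (h : Γ.src e ≠ v) (m : List E) :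
    Γ.leavittGhost K e * Γ.leavittMonomial K v [] m = 0 := by
  rw [← ghost_mul_src, mul_assoc, vertex_mul_monomial_ne h, mul_zero]

/-- A monomial whose second list of edges does not form a path vanishes. -/
theorem ghostMonomial_eq_zero_or (x : Γ.Path) (m : List E) :
    Γ.ghostMonomial K x.start m = 0 ∨ ∃ y, IsConcat m x y := by
  induction m with
  | nil => exact Or.inr ⟨x, rfl⟩
  | cons e m ih =>
    rcases ih with h | ⟨y, hy⟩
    · exact Or.inl (by rw [ghostMonomial, h, zero_mul])
    · by_cases he : Γ.listStart x.start m = Γ.rng e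
      · obtain ⟨z, hz⟩ := exists_isCons (hy.start.trans he)
        exact Or.inr ⟨z, y, hy, hz⟩
      · left
        have h := monomial_mul_listStart (K := K) (Γ := Γ) x.start [] m
        rw [leavittMonomial] at h
        rw [ghostMonomial, ← h, ← rng_mul_ghost, mul_assoc, ← mul_assoc (Γ.leavittVertex K _),
          vertex_mul_ne he, zero_mul, mul_zero]

variable (Γ K) in
/-- The span of the monomials `α β*`, with the paths `α` restricted to the set `L`. -/
noncomputable def monomialSpan (L : Set (List E)) : Submodule K (Γ.LeavittPathAlgebra K) :=
  Submodule.span K {x | ∃ v, ∃ l ∈ L, ∃ m, x = Γ.leavittMonomial K v l m}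

theorem monomial_mem {L : Set (List E)} {l : List E} (hl : l ∈ L) (v : V) (m : List E) :
    Γ.leavittMonomial K v l m ∈ Γ.monomialSpan K L :=
  Submodule.subset_span ⟨v, l, hl, m, rfl⟩

/-- A linear map preserves spans of monomials if it maps the monomials accordingly. -/
theorem map_mem_of_monomial {A : Type*} [AddCommGroup A] [Module K A] {N : Submodule K A}
    {L : Set (List E)} (φ : Γ.LeavittPathAlgebra K →ₗ[K] A)
    (h : ∀ v, ∀ l ∈ L, ∀ m, φ (Γ.leavittMonomial K v l m) ∈ N) {x : Γ.LeavittPathAlgebra K}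
    (hx : x ∈ Γ.monomialSpan K L) : φ x ∈ N := by
  have : Γ.monomialSpan K L ≤ N.comap φ := by
    refine Submodule.span_le.2 ?_
    rintro _ ⟨v, l, hl, m, rfl⟩
    exact h v l hl m
  exact this hx

theorem vertex_mul_mem {L : Set (List E)} (u : V) {x : Γ.LeavittPathAlgebra K}
    (hx : x ∈ Γ.monomialSpan K L) : Γ.leavittVertex K u * x ∈ Γ.monomialSpan K L := by
  refine map_mem_of_monomial (LinearMap.mulLeft K _) (fun v l hl m => ?_) hx
  rw [LinearMap.mulLeft_apply]
  by_cases h : u = Γ.listStart v l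
  · rw [h, listStart_mul_monomial]
    exact monomial_mem hl v m
  · rw [vertex_mul_monomial_ne h]
    exact Submodule.zero_mem _

theorem ghost_mul_mem {L L' : Set (List E)} (e : E) (hnil : [] ∈ L → [] ∈ L')
    (hcons : ∀ l, e :: l ∈ L → l ∈ L') {x : Γ.LeavittPathAlgebra K}
    (hx : x ∈ Γ.monomialSpan K L) : Γ.leavittGhost K e * x ∈ Γ.monomialSpan K L' := by
  refine map_mem_of_monomial (LinearMap.mulLeft K _) (fun v l hl m => ?_) hx
  rw [LinearMap.mulLeft_apply]
  cases l with
  | nil =>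
    by_cases h : Γ.src e = v
    · rw [← h, ghost_mul_monomial_nil]
      exact monomial_mem (hnil hl) _ _
    · rw [ghost_mul_monomial_nil_ne h]
      exact Submodule.zero_mem _
  | cons f l =>
    by_cases h : e = f
    · subst h
      rw [ghost_mul_monomial_cons]
      exact vertex_mul_mem _ (monomial_mem (hcons l hl) _ _)
    · rw [ghost_mul_monomial_cons_ne h]
      exact Submodule.zero_mem _

theorem edge_mul_mem (e : E) {x : Γ.LeavittPathAlgebra K}
    (hx : x ∈ Γ.monomialSpan K Set.univ) :
    Γ.leavittEdge K e * x ∈ Γ.monomialSpan K Set.univ :=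
  map_mem_of_monomial (LinearMap.mulLeft K _)
    (fun v l _ m => monomial_mem (Set.mem_univ (e :: l)) v m) hx

/-- The monomials `α β*` span the Leavitt path algebra. -/
theorem monomialSpan_univ : Γ.monomialSpan K Set.univ = ⊤ := by
  refine Submodule.eq_top_iff'.2 fun x => ?_
  obtain ⟨x, rfl⟩ := Γ.leavittMk_surjective K x
  induction x using MonoidAlgebra.induction_linear with
  | zero => exact Submodule.zero_mem _
  | add x y hx hy => exact Submodule.add_mem _ hx hy
  | single w k =>
    have hw : Γ.leavittMk K (MonoidAlgebra.single w 1) ∈ Γ.monomialSpan K Set.univ := by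
      induction w using FreeSemigroup.recOnMul with
      | ih1 x =>
        cases x with
        | vertex v => exact monomial_mem (Set.mem_univ []) v []
        | edge e =>
          have := monomial_mem (K := K) (Γ := Γ) (Set.mem_univ [e]) (Γ.rng e) []
          rwa [leavittMonomial, leavittMonomial, ghostMonomial, edge_mul_rng] at this
        | ghost e =>
          have := monomial_mem (K := K) (Γ := Γ) (Set.mem_univ []) (Γ.rng e) [e]
          rwa [leavittMonomial, ghostMonomial, ghostMonomial, rng_mul_ghost] at this
      | ih2 x y _ ih =>
        have h : (MonoidAlgebra.single (FreeSemigroup.of x * y) 1 : LeavittFree V E K) =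
            freeGen K x * MonoidAlgebra.single y 1 := by
          rw [freeGen, MonoidAlgebra.single_mul_single, one_mul]
        rw [h, leavittMk_mul]
        cases x with
        | vertex v => exact vertex_mul_mem v ih
        | edge e => exact edge_mul_mem e ih
        | ghost e => exact ghost_mul_mem e (fun h => h) (fun _ _ => Set.mem_univ _) ih
    have h : (MonoidAlgebra.single w k : LeavittFree V E K) =
        k • MonoidAlgebra.single w 1 := by simp
    rw [h]
    exact Submodule.smul_mem _ k hw

theorem mem_monomialSpan_univ (x : Γ.LeavittPathAlgebra K) :
    x ∈ Γ.monomialSpan K Set.univ := by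
  rw [monomialSpan_univ]
  trivial

/-! ### Vanishing criteria in the Leavitt path algebra -/

/-- Finitely many vertices add up to a local left unit. -/
theorem eq_zero_of_vertex_mul {x : Γ.LeavittPathAlgebra K}
    (h : ∀ v, Γ.leavittVertex K v * x = 0) : x = 0 := by
  classical
  obtain ⟨F, hF⟩ : ∃ F : Finset V, ∀ F', F ⊆ F' → ∑ v ∈ F', Γ.leavittVertex K v * x = x := by
    clear h
    induction mem_monomialSpan_univ x using Submodule.span_induction with
    | mem x hx =>
      obtain ⟨v, l, -, m, rfl⟩ := hx
      refine ⟨{Γ.listStart v l}, fun F' hF' => ?_⟩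
      rw [Finset.sum_eq_single_of_mem (Γ.listStart v l) (hF' (Finset.mem_singleton_self _)),
        listStart_mul_monomial]
      exact fun u _ hu => vertex_mul_monomial_ne hu
    | zero => exact ⟨∅, fun F' _ => by simp⟩
    | add x y _ _ hx hy =>
      obtain ⟨F₁, h₁⟩ := hx
      obtain ⟨F₂, h₂⟩ := hy
      refine ⟨F₁ ∪ F₂, fun F' hF' => ?_⟩
      simp only [mul_add, Finset.sum_add_distrib]
      rw [h₁ F' (Finset.union_subset_left hF'), h₂ F' (Finset.union_subset_right hF')]
    | smul k x _ hx =>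
      obtain ⟨F, hF⟩ := hx
      exact ⟨F, fun F' hF' => by simp only [mul_smul_comm, ← Finset.smul_sum, hF F' hF']⟩
  rw [← hF F subset_rfl]
  exact Finset.sum_eq_zero fun v _ => h v

/-- On combinations of monomials `α β*` with `α` of positive length, the elements `e e*` add up to
a local left unit. -/
theorem eq_zero_of_ghost_mul {x : Γ.LeavittPathAlgebra K}
    (hx : x ∈ Γ.monomialSpan K {l | l ≠ []}) (h : ∀ e, Γ.leavittGhost K e * x = 0) : x = 0 := by
  classical
  obtain ⟨F, hF⟩ : ∃ F : Finset E, ∀ F', F ⊆ F' →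
      ∑ e ∈ F', Γ.leavittEdge K e * (Γ.leavittGhost K e * x) = x := by
    clear h
    induction hx using Submodule.span_induction with
    | mem x hx =>
      obtain ⟨v, l, hl, m, rfl⟩ := hx
      cases l with
      | nil => exact absurd rfl hl
      | cons f l =>
        refine ⟨{f}, fun F' hF' => ?_⟩
        rw [Finset.sum_eq_single_of_mem f (hF' (Finset.mem_singleton_self _)),
          ghost_mul_monomial_cons, ← mul_assoc, edge_mul_rng]
        · rfl
        · intro e _ he
          rw [ghost_mul_monomial_cons_ne he, mul_zero]
    | zero => exact ⟨∅, fun F' _ => by simp⟩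
    | add x y _ _ hx hy =>
      obtain ⟨F₁, h₁⟩ := hx
      obtain ⟨F₂, h₂⟩ := hy
      refine ⟨F₁ ∪ F₂, fun F' hF' => ?_⟩
      simp only [mul_add, Finset.sum_add_distrib]
      rw [h₁ F' (Finset.union_subset_left hF'), h₂ F' (Finset.union_subset_right hF')]
    | smul k x _ hx =>
      obtain ⟨F, hF⟩ := hx
      exact ⟨F, fun F' hF' => by simp only [mul_smul_comm, ← Finset.smul_sum, hF F' hF']⟩
  rw [← hF F subset_rfl]
  exact Finset.sum_eq_zero fun e _ => by rw [h e, mul_zero]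

/-- At a regular vertex `v`, the relation `v = ∑ e e*` provides a local left unit. -/
theorem eq_zero_of_ghost_mul_of_regular {v : V} (hne : {e | Γ.src e = v}.Nonempty)
    (hfin : {e | Γ.src e = v}.Finite) {x : Γ.LeavittPathAlgebra K}
    (hx : Γ.leavittVertex K v * x = x) (h : ∀ e, Γ.leavittGhost K e * x = 0) : x = 0 := by
  rw [← hx, vertex_eq_sum v hne hfin, Finset.sum_mul]
  exact Finset.sum_eq_zero fun e _ => by rw [mul_assoc, h e, mul_zero]

/-! ### Products of cylinders -/

/-- `Z(α, κ) Z(κ ι, μ) = Z(α ι, μ)`, where `l`, `k`, `j`, `m` are the edges of `α`, `κ`, `ι`, `μ`;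
the hypotheses say that `κ ι` is a path. -/
theorem setMul_cyl {v w : V} {l k j m : List E} (hv : v = Γ.listStart w j)
    (hk : ∀ x : Γ.Path, x.start = v → ∃ y, IsConcat k x y) :
    setMul (Γ.cyl v l k) (Γ.cyl w (k ++ j) m) = Γ.cyl w (l ++ j) m := by
  have key : ∀ α ∈ Γ.cyl v l k, ∀ β ∈ Γ.cyl w (k ++ j) m, ∀ h,
      comp α β h ∈ Γ.cyl w (l ++ j) m := by
    intro α hα β hβ h
    obtain ⟨y, rfl, h1, -, -⟩ := id hβ
    rw [← src_eq_rng_iff.1 h] at h1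
    exact comp_mem_cyl (mem_cyl_append_of_source hα h1) hβ h
  ext γ
  constructor
  · rintro ⟨α, hα, β, hβ, h, rfl⟩
    exact key α hα β hβ h
  · intro hγ
    obtain ⟨y, rfl, h1, h2, h3⟩ := id hγ
    obtain ⟨z, hz, hz'⟩ := isConcat_append.1 h1
    have hzv := hz.start.trans hv.symm
    obtain ⟨b, hb⟩ := hk z hzv
    obtain ⟨α, hα, hαt, hαs⟩ := exists_mem_cyl (hz'.isBoundary_iff.1 γ.target.2) hz' hb
    obtain ⟨β, hβ, hβt, hβs⟩ := exists_mem_cyl (h3.isBoundary_iff.1 γ.source.2)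
      (isConcat_append.2 ⟨z, hz, hb⟩) h3
    rw [hzv] at hα
    have h : ArrowGroupoid.src α = ArrowGroupoid.rng β :=
      src_eq_rng_iff.2 (Subtype.ext (hαs.trans hβt.symm))
    exact ⟨α, hα, β, hβ, h, injOn_target_cyl (key α hα β hβ h) hγ hαt⟩

/-- `Z(α, κ ι) Z(κ, μ) = Z(α, μ ι)`, where `l`, `k`, `j`, `m` are the edges of `α`, `κ`, `ι`, `μ`;
the hypotheses say that `κ ι` is a path. -/
theorem setMul_cyl' {v w : V} {l k j m : List E} (hv : v = Γ.listStart w j)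
    (hk : ∀ x : Γ.Path, x.start = v → ∃ y, IsConcat k x y) :
    setMul (Γ.cyl w l (k ++ j)) (Γ.cyl v k m) = Γ.cyl w l (m ++ j) := by
  have key : ∀ α ∈ Γ.cyl w l (k ++ j), ∀ β ∈ Γ.cyl v k m, ∀ h,
      comp α β h ∈ Γ.cyl w l (m ++ j) := by
    intro α hα β hβ h
    obtain ⟨y, rfl, -, -, h1⟩ := id hα
    rw [src_eq_rng_iff.1 h] at h1
    exact comp_mem_cyl hα (mem_cyl_append_of_target hβ h1) h
  ext γ
  constructor
  · rintro ⟨α, hα, β, hβ, h, rfl⟩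
    exact key α hα β hβ h
  · intro hγ
    obtain ⟨y, rfl, h1, h2, h3⟩ := id hγ
    obtain ⟨z, hz, hz'⟩ := isConcat_append.1 h3
    have hzv := hz.start.trans hv.symm
    obtain ⟨b, hb⟩ := hk z hzv
    obtain ⟨β, hβ, hβt, hβs⟩ := exists_mem_cyl (hz'.isBoundary_iff.1 γ.source.2) hb hz'
    obtain ⟨α, hα, hαt, hαs⟩ := exists_mem_cyl (h1.isBoundary_iff.1 γ.target.2) h1
      (isConcat_append.2 ⟨z, hz, hb⟩)
    rw [hzv] at hβ
    have h : ArrowGroupoid.src α = ArrowGroupoid.rng β :=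
      src_eq_rng_iff.2 (Subtype.ext (hαs.trans hβt.symm))
    exact ⟨α, hα, β, hβ, h, injOn_target_cyl (key α hα β hβ h) hγ hαt⟩

theorem exists_isConcat_nil (x : Γ.Path) : ∃ y, IsConcat [] x y := ⟨x, rfl⟩

variable (Γ K) in
/-- The characteristic function of a cylinder, as an element of the Steinberg algebra. -/
noncomputable def cylFn (v : V) (l m : List E) : SteinbergAlgebra K Γ.GraphGroupoid :=
  ⟨(Γ.cyl v l m).indicator fun _ => 1,
    Submodule.subset_span ⟨_, isCompact_cyl v l m, isOpenBisection_cyl v l m, rfl⟩⟩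

theorem cylFn_mul {v w u : V} {l m l' m' a b : List E}
    (h : setMul (Γ.cyl v l m) (Γ.cyl w l' m') = Γ.cyl u a b) :
    Γ.cylFn K v l m * Γ.cylFn K w l' m' = Γ.cylFn K u a b :=
  Subtype.ext ((convolution_indicator (isOpenBisection_cyl v l m)).trans (by rw [h]; rfl))

theorem cylFn_mul_eq_zero {v w : V} {l m l' m' : List E}
    (h : ∀ α ∈ Γ.cyl v l m, ∀ β ∈ Γ.cyl w l' m', α.source.1 ≠ β.target.1) :
    Γ.cylFn K v l m * Γ.cylFn K w l' m' = 0 := by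
  have he : setMul (Γ.cyl v l m) (Γ.cyl w l' m') = ∅ := by
    refine Set.eq_empty_of_forall_notMem ?_
    rintro _ ⟨α, hα, β, hβ, hαβ, rfl⟩
    exact h α hα β hβ (congrArg Subtype.val (src_eq_rng_iff.1 hαβ))
  refine Subtype.ext ((convolution_indicator (isOpenBisection_cyl v l m)).trans ?_)
  rw [he, Set.indicator_empty]
  rfl

theorem cylFn_mul_eq_zero_of_start {v w : V} {l m l' m' : List E}
    (h : Γ.listStart v m ≠ Γ.listStart w l') :
    Γ.cylFn K v l m * Γ.cylFn K w l' m' = 0 :=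
  cylFn_mul_eq_zero fun α hα β hβ he => h (by
    rw [← start_source_of_mem_cyl hα, he, start_target_of_mem_cyl hβ])

theorem edge_cylFn_mul (e : E) {v : V} {l m : List E} (h : Γ.rng e = Γ.listStart v l) :
    Γ.cylFn K (Γ.rng e) [e] [] * Γ.cylFn K v l m = Γ.cylFn K v (e :: l) m :=
  cylFn_mul (setMul_cyl (k := []) h fun x _ => exists_isConcat_nil x)

theorem cylFn_mul_ghost (e : E) {v : V} {m : List E} (h : Γ.rng e = Γ.listStart v m) :
    Γ.cylFn K v [] m * Γ.cylFn K (Γ.rng e) [] [e] = Γ.cylFn K v [] (e :: m) :=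
  cylFn_mul (setMul_cyl' (k := []) h fun x _ => exists_isConcat_nil x)

/-- Evaluation of elements of a Steinberg algebra, as a linear map. -/
def steinbergVal (K : Type w) [Field K] (G : Type u') [TopologicalSpace G] [ArrowGroupoid G] :
    SteinbergAlgebra K G →ₗ[K] (G → K) :=
  (steinbergSubmodule K G).subtype

/-- If `v` is regular, then every boundary path with source `v` starts with an edge, so `Z(v, v)` is
the disjoint union of the sets `Z(e, e)` with `s(e) = v`. -/
theorem cylFn_vertex_eq_sum {v : V} (hne : {e | Γ.src e = v}.Nonempty)
    (hfin : {e | Γ.src e = v}.Finite) :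
    Γ.cylFn K v [] [] = ∑ e ∈ hfin.toFinset, Γ.cylFn K (Γ.rng e) [e] [e] := by
  refine (steinbergSubmodule K Γ.GraphGroupoid).injective_subtype ?_
  change steinbergVal K _ _ = steinbergVal K _ _
  rw [map_sum]
  funext g
  rw [Finset.sum_apply]
  change (Γ.cyl v [] []).indicator (fun _ => (1 : K)) g =
    ∑ e ∈ hfin.toFinset, (Γ.cyl (Γ.rng e) [e] [e]).indicator (fun _ => (1 : K)) g
  by_cases hg : g ∈ Γ.cyl v [] []
  · rw [Set.indicator_of_mem hg]
    obtain ⟨x, rfl, h1, h2, h3⟩ := id hg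
    rcases exists_isCons_or_eq_vertex x with ⟨e, y, hy⟩ | hx
    · rw [Finset.sum_eq_single_of_mem e (by simpa using hy.start_right.symm),
        Set.indicator_of_mem]
      · rw [← hy.start_left]
        exact mem_cyl_append_of_target (l := []) (m := []) (k := [e]) hg
          (isConcat_append.2 ⟨x, isConcat_singleton.2 hy, h1⟩)
      · intro f _ hf
        refine Set.indicator_of_notMem ?_ _
        rintro ⟨z, -, hz, -, -⟩
        have h1 : x = g.target.1 := h1
        rw [← h1] at hz
        exact hf ((isConcat_singleton.1 hz).inj hy).1
    · have hb := h1.isBoundary_iff.1 g.target.2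
      rw [hx] at hb
      rcases hb with hb | hb
      · exact absurd hb hne.ne_empty
      · exact absurd hfin hb
  · rw [Set.indicator_of_notMem hg]
    refine (Finset.sum_eq_zero fun e he => Set.indicator_of_notMem (fun h => hg ?_) _).symm
    exact mem_cyl_append (l := []) (m := []) (k := [e]) h
      (hfin.mem_toFinset.1 he)

/-! ### The homomorphism to the Steinberg algebra -/

variable (Γ K) in
/-- The images of the generators under the homomorphism `toSteinberg`. -/
noncomputable def steinbergGen : LeavittGen V E → SteinbergAlgebra K Γ.GraphGroupoid
  | .vertex v => Γ.cylFn K v [] []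
  | .edge e => Γ.cylFn K (Γ.rng e) [e] []
  | .ghost e => Γ.cylFn K (Γ.rng e) [] [e]

theorem steinbergGen_rel (x y : LeavittFree V E K) (h : Γ.LeavittRel K x y) :
    freeLift (Γ.steinbergGen K) x = freeLift (Γ.steinbergGen K) y := by
  cases h with
  | vertex_mul_self v =>
    simp only [map_mul, freeLift_freeGen, steinbergGen]
    exact cylFn_mul (setMul_cyl (k := []) (j := []) rfl fun x _ => exists_isConcat_nil x)
  | vertex_mul_ne v w hvw =>
    simp only [map_mul, map_zero, freeLift_freeGen, steinbergGen]
    exact cylFn_mul_eq_zero_of_start hvw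
  | src_mul_edge e =>
    simp only [map_mul, freeLift_freeGen, steinbergGen]
    exact cylFn_mul (setMul_cyl (k := []) (j := [e]) rfl fun x _ => exists_isConcat_nil x)
  | edge_mul_rng e =>
    simp only [map_mul, freeLift_freeGen, steinbergGen]
    exact edge_cylFn_mul e rfl
  | rng_mul_ghost e =>
    simp only [map_mul, freeLift_freeGen, steinbergGen]
    exact cylFn_mul_ghost e rfl
  | ghost_mul_src e =>
    simp only [map_mul, freeLift_freeGen, steinbergGen]
    exact cylFn_mul (setMul_cyl' (k := []) (j := [e]) rfl fun x _ => exists_isConcat_nil x)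
  | ghost_mul_self e =>
    simp only [map_mul, freeLift_freeGen, steinbergGen]
    exact cylFn_mul (setMul_cyl (k := [e]) (j := []) rfl fun x hx =>
      (exists_isCons hx).imp fun y hy => isConcat_singleton.2 hy)
  | ghost_mul_ne e f hef =>
    simp only [map_mul, map_zero, freeLift_freeGen, steinbergGen]
    refine cylFn_mul_eq_zero ?_
    rintro α ⟨x, -, -, -, hx⟩ β ⟨y, -, hy, -, -⟩ he
    rw [he] at hx
    exact hef ((isConcat_singleton.1 hx).inj (isConcat_singleton.1 hy)).1
  | regular v hne hfin =>
    simp only [map_mul, map_sum, freeLift_freeGen, steinbergGen]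
    rw [cylFn_vertex_eq_sum hne hfin]
    exact Finset.sum_congr rfl fun e _ =>
      (edge_cylFn_mul e (v := Γ.rng e) (l := []) (m := [e]) rfl).symm

variable (Γ K) in
/-- The homomorphism from the Leavitt path algebra to the Steinberg algebra of the graph groupoid
that maps `α β*` to the characteristic function of `Z(α, β)`. -/
noncomputable def toSteinberg :
    Γ.LeavittPathAlgebra K →ₙₐ[K] SteinbergAlgebra K Γ.GraphGroupoid :=
  leavittLift (Γ.steinbergGen K) steinbergGen_rel

theorem toSteinberg_vertex (v : V) :
    Γ.toSteinberg K (Γ.leavittVertex K v) = Γ.cylFn K v [] [] :=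
  (leavittLift_leavittMk _ _ _).trans (freeLift_freeGen _ _)

theorem toSteinberg_edge (e : E) :
    Γ.toSteinberg K (Γ.leavittEdge K e) = Γ.cylFn K (Γ.rng e) [e] [] :=
  (leavittLift_leavittMk _ _ _).trans (freeLift_freeGen _ _)

theorem toSteinberg_ghost (e : E) :
    Γ.toSteinberg K (Γ.leavittGhost K e) = Γ.cylFn K (Γ.rng e) [] [e] :=
  (leavittLift_leavittMk _ _ _).trans (freeLift_freeGen _ _)

theorem cylFn_eq_zero {v : V} {l m : List E} (h : Γ.cyl v l m = ∅) : Γ.cylFn K v l m = 0 :=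
  Subtype.ext ((congrArg (fun U => U.indicator fun _ => (1 : K)) h).trans (Set.indicator_empty _))

theorem toSteinberg_ghostMonomial (v : V) (m : List E) :
    Γ.toSteinberg K (Γ.ghostMonomial K v m) = Γ.cylFn K v [] m := by
  induction m with
  | nil => exact toSteinberg_vertex v
  | cons e m ih =>
    rw [ghostMonomial, map_mul, ih, toSteinberg_ghost]
    by_cases h : Γ.rng e = Γ.listStart v m
    · exact cylFn_mul_ghost e h
    · rw [cylFn_mul_eq_zero_of_start (m := m) (l' := []) (Ne.symm h), cylFn_eq_zero]
      refine Set.eq_empty_of_forall_notMem ?_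
      rintro g ⟨x, rfl, -, -, z, hz, hz'⟩
      exact h (hz'.start_left.symm.trans hz.start)

theorem toSteinberg_monomial (v : V) (l m : List E) :
    Γ.toSteinberg K (Γ.leavittMonomial K v l m) = Γ.cylFn K v l m := by
  induction l with
  | nil => exact toSteinberg_ghostMonomial v m
  | cons e l ih =>
    rw [leavittMonomial, map_mul, ih, toSteinberg_edge]
    by_cases h : Γ.rng e = Γ.listStart v l
    · exact edge_cylFn_mul e h
    · rw [cylFn_mul_eq_zero_of_start (m := []) (l' := l) h, cylFn_eq_zero]
      refine Set.eq_empty_of_forall_notMem ?_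
      rintro g ⟨x, rfl, ⟨z, hz, hz'⟩, -, -⟩
      exact h (hz'.start_left.symm.trans hz.start)

/-! ### Injectivity -/

variable (Γ K) in
/-- The value at an arrow of the image of an element of the Leavitt path algebra. -/
noncomputable def evalAt (g : Γ.GraphGroupoid) : Γ.LeavittPathAlgebra K →ₗ[K] K :=
  (LinearMap.proj g).comp ((steinbergVal K _).comp
    ((Γ.toSteinberg K : Γ.LeavittPathAlgebra K →ₗ[K] SteinbergAlgebra K Γ.GraphGroupoid)))

theorem evalAt_apply (g : Γ.GraphGroupoid) (x : Γ.LeavittPathAlgebra K) :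
    Γ.evalAt K g x = (Γ.toSteinberg K x).1 g := rfl

theorem evalAt_monomial (g : Γ.GraphGroupoid) (v : V) (l m : List E) :
    Γ.evalAt K g (Γ.leavittMonomial K v l m) = (Γ.cyl v l m).indicator (fun _ => (1 : K)) g := by
  rw [evalAt_apply, toSteinberg_monomial]
  rfl

/-- A combination of monomials `β*` with `r(β) = s(x)` can be recovered from the values of its image
at the arrows `(x, -|β|, β x)`. -/
theorem eq_zero_of_evalAt {x : Γ.Path} (hx : Γ.IsBoundary x) {y : Γ.LeavittPathAlgebra K}
    (hy : y ∈ Γ.monomialSpan K {[]}) (hxy : Γ.leavittVertex K x.start * y = y)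
    (h : ∀ g : Γ.GraphGroupoid, g.target.1 = x → Γ.evalAt K g y = 0) : y = 0 := by
  classical
  have hspan : y ∈ Submodule.span K (Set.range fun m => Γ.leavittMonomial K x.start [] m) := by
    rw [← hxy]
    refine map_mem_of_monomial (LinearMap.mulLeft K _) (fun v l hl m => ?_) hy
    obtain rfl : l = [] := hl
    rw [LinearMap.mulLeft_apply]
    by_cases hv : x.start = v
    · rw [← hv]
      have := listStart_mul_monomial (K := K) (Γ := Γ) x.start [] m
      rw [listStart] at this
      rw [this]
      exact Submodule.subset_span ⟨m, rfl⟩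
    · rw [vertex_mul_monomial_ne hv]
      exact Submodule.zero_mem _
  obtain ⟨c, rfl⟩ := Finsupp.mem_span_range_iff_exists_finsupp.1 hspan
  refine Finset.sum_eq_zero fun m hm => ?_
  change c m • Γ.leavittMonomial K x.start [] m = 0
  rcases ghostMonomial_eq_zero_or (K := K) x m with h0 | ⟨z, hz⟩
  · rw [leavittMonomial, h0, smul_zero]
  · obtain ⟨g, hg, hgt, hgs⟩ := exists_mem_cyl (l := []) hx rfl hz
    -- the other monomials vanish at the arrow `(x, -|m|, m x)`
    have hval := h g hgt
    rw [Finsupp.sum, map_sum, Finset.sum_eq_single_of_mem m hm] at hval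
    · rw [map_smul, evalAt_monomial, Set.indicator_of_mem hg, smul_eq_mul, mul_one] at hval
      rw [hval, zero_smul]
    · intro m' _ hne
      rw [map_smul, evalAt_monomial, Set.indicator_of_notMem, smul_zero]
      intro hg'
      obtain ⟨t, -, h1, h2, h3⟩ := hg
      obtain ⟨t', -, h1', h2', h3'⟩ := hg'
      exact hne (h3'.inj h3 (by simp only [List.length_nil] at *; omega)).1

/-- Monomials `α β*` with `α` of positive length are mapped to functions that vanish at all arrows
whose range is a vertex. -/
theorem evalAt_eq_zero_of_vertex {L : Set (List E)} (hL : [] ∉ L) {y : Γ.LeavittPathAlgebra K}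
    (hy : y ∈ Γ.monomialSpan K L) {g : Γ.GraphGroupoid} {v : V}
    (hg : g.target.1 = .fin (FinPath.vertex Γ v)) : Γ.evalAt K g y = 0 := by
  refine (Submodule.mem_bot K).1 (map_mem_of_monomial (Γ.evalAt K g) (fun v l hl m => ?_) hy)
  rw [evalAt_monomial, Set.indicator_of_notMem]
  · exact Submodule.zero_mem _
  · rintro ⟨x, -, h, -, -⟩
    rw [hg] at h
    rw [h.eq_nil_of_vertex] at hl
    exact hL hl

/-- Injectivity on combinations of monomials `α β*` with `|α| ≤ n`, by induction on `n`. Left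
multiplication by vertices and ghost edges reduces the claim to smaller `n`, up to a combination of
monomials `β*`, which is detected by evaluation. -/
theorem eq_zero_of_toSteinberg_eq_zero (n : ℕ) {x : Γ.LeavittPathAlgebra K}
    (hx : x ∈ Γ.monomialSpan K {l | l.length ≤ n}) (h : Γ.toSteinberg K x = 0) : x = 0 := by
  induction n generalizing x with
  | zero =>
    refine eq_zero_of_vertex_mul fun v => ?_
    obtain ⟨p, hp, rfl⟩ := exists_isBoundary Γ v
    refine eq_zero_of_evalAt hp (vertex_mul_mem _ ?_) (by rw [← mul_assoc, vertex_mul_self]) ?_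
    · convert hx using 2
      ext l
      simp
    · intro g _
      rw [evalAt_apply, map_mul, h, mul_zero]
      rfl
  | succ n ih =>
    have hghost : ∀ z ∈ Γ.monomialSpan K {l | l.length ≤ n + 1}, Γ.toSteinberg K z = 0 →
        ∀ e, Γ.leavittGhost K e * z = 0 := by
      refine fun z hz hz0 e => ih (ghost_mul_mem e (fun _ => Nat.zero_le _) ?_ hz) ?_
      · exact fun l hl => Nat.le_of_succ_le_succ hl
      · rw [map_mul, hz0, mul_zero]
    refine eq_zero_of_vertex_mul fun v => ?_
    have hvx := vertex_mul_mem v hx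
    have hv0 : Γ.toSteinberg K (Γ.leavittVertex K v * x) = 0 := by rw [map_mul, h, mul_zero]
    have hvv : ∀ z, Γ.leavittVertex K v * (Γ.leavittVertex K v * z) = Γ.leavittVertex K v * z := by
      intro z
      rw [← mul_assoc, vertex_mul_self]
    by_cases hv : Γ.IsBoundary (.fin (FinPath.vertex Γ v))
    · -- at a sink or an infinite emitter, evaluation at arrows with range `v` isolates the `β*`
      obtain ⟨y, hy, z, hz, rfl⟩ : ∃ y ∈ Γ.monomialSpan K {[]},
          ∃ z ∈ Γ.monomialSpan K {l | l ≠ [] ∧ l.length ≤ n + 1}, y + z = x := by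
        rw [← Submodule.mem_sup]
        refine (Submodule.span_le.2 ?_ : Γ.monomialSpan K {l | l.length ≤ n + 1} ≤ _) hx
        rintro _ ⟨u, l, hl, m, rfl⟩
        by_cases hl' : l = []
        · exact Submodule.mem_sup_left (monomial_mem (L := {[]}) hl' u m)
        · exact Submodule.mem_sup_right
            (monomial_mem (L := {l | l ≠ [] ∧ l.length ≤ n + 1}) ⟨hl', hl⟩ u m)
      have hz' := vertex_mul_mem v hz
      have hy0 : Γ.leavittVertex K v * y = 0 := by
        refine eq_zero_of_evalAt hv (vertex_mul_mem v hy) (hvv y) fun g hg => ?_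
        have h1 : Γ.evalAt K g (Γ.leavittVertex K v * (y + z)) = 0 := by
          rw [evalAt_apply, hv0]
          rfl
        rwa [mul_add, map_add, evalAt_eq_zero_of_vertex (fun hl => hl.1 rfl) hz' hg,
          add_zero] at h1
      rw [mul_add, hy0, zero_add] at hvx hv0 ⊢
      exact eq_zero_of_ghost_mul (Submodule.span_mono (by
        rintro _ ⟨u, l, hl, m, rfl⟩
        exact ⟨u, l, hl.1, m, rfl⟩) hz') (hghost _ hvx hv0)
    · have hv : ¬ ({e | Γ.src e = v} = ∅ ∨ {e | Γ.src e = v}.Infinite) := hv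
      rw [not_or, Set.not_infinite] at hv
      exact eq_zero_of_ghost_mul_of_regular (Set.nonempty_iff_ne_empty.2 hv.1) hv.2 (hvv x)
        (hghost _ hvx hv0)

theorem toSteinberg_injective : Function.Injective (Γ.toSteinberg K) := by
  refine (injective_iff_map_eq_zero _).2 fun x hx => ?_
  obtain ⟨n, hn⟩ : ∃ n, x ∈ Γ.monomialSpan K {l | l.length ≤ n} := by
    have hmono : ∀ a b : ℕ, a ≤ b → Γ.monomialSpan K {l | l.length ≤ a} ≤
        Γ.monomialSpan K {l | l.length ≤ b} := by
      intro a b hab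
      refine Submodule.span_mono ?_
      rintro _ ⟨u, l, hl, m, rfl⟩
      exact ⟨u, l, le_trans hl hab, m, rfl⟩
    clear hx
    induction mem_monomialSpan_univ x using Submodule.span_induction with
    | mem x hx =>
      obtain ⟨v, l, -, m, rfl⟩ := hx
      exact ⟨l.length, monomial_mem (le_refl l.length) v m⟩
    | zero => exact ⟨0, Submodule.zero_mem _⟩
    | add x y _ _ hx hy =>
      obtain ⟨a, ha⟩ := hx
      obtain ⟨b, hb⟩ := hy
      exact ⟨max a b, Submodule.add_mem _ (hmono _ _ (le_max_left a b) ha)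
        (hmono _ _ (le_max_right a b) hb)⟩
    | smul k x _ hx =>
      obtain ⟨a, ha⟩ := hx
      exact ⟨a, Submodule.smul_mem _ k ha⟩
  exact eq_zero_of_toSteinberg_eq_zero n hn hx

end DirectedGraph

namespace ArrowGroupoid

/-! ### Steinberg algebras of clopen subgroupoids -/

variable {K : Type w} [Field K] {G : Type u} [TopologicalSpace G] [ArrowGroupoid G]
  {S : Subgroupoid G}

section

variable [IsTopologicalGroupoid G]

/-- Functions in the Steinberg algebra restrict to a clopen subgroupoid; closedness is what keeps the
traces of compact sets compact. -/
theorem comp_val_mem_steinbergSubmodule (hS : IsClopen S.carrier)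
    (hsrc : IsOpenMap (src : G → G)) {f : G → K} (hf : f ∈ steinbergSubmodule K G) :
    (fun g : S.carrier => f g.1) ∈ steinbergSubmodule K S.carrier := by
  have : steinbergSubmodule K G ≤
      (steinbergSubmodule K S.carrier).comap (LinearMap.funLeft K K Subtype.val) := by
    refine Submodule.span_le.2 ?_
    rintro _ ⟨U, hUc, hU, rfl⟩
    refine Submodule.subset_span ⟨Subtype.val ⁻¹' U,
      hS.isClosed.isClosedEmbedding_subtypeVal.isCompact_preimage hUc,
      isOpenBisection_of_injOn (S.isOpenMap_src hS.isOpen hsrc)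
        (hU.isOpen.preimage continuous_subtype_val) ?_ ?_, rfl⟩
    · exact fun a ha b hb h => Subtype.ext (hU.src_inj ha hb (congrArg Subtype.val h))
    · exact fun a ha b hb h => Subtype.ext (hU.rng_inj ha hb (congrArg Subtype.val h))
  exact this hf

theorem exists_extension_mem_steinbergSubmodule (hS : IsOpen S.carrier)
    (hsrc : IsOpenMap (src : G → G)) {f : S.carrier → K}
    (hf : f ∈ steinbergSubmodule K S.carrier) :
    ∃ F ∈ steinbergSubmodule K G, (fun g : S.carrier => F g.1) = f := by
  have : steinbergSubmodule K S.carrier ≤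
      (steinbergSubmodule K G).map (LinearMap.funLeft K K Subtype.val) := by
    refine Submodule.span_le.2 ?_
    rintro _ ⟨U, hUc, hU, rfl⟩
    refine ⟨(Subtype.val '' U).indicator fun _ => 1,
      Submodule.subset_span ⟨_, hUc.image continuous_subtype_val,
        isOpenBisection_of_injOn hsrc (hS.isOpenMap_subtype_val _ hU.isOpen) ?_ ?_, rfl⟩, ?_⟩
    · rintro _ ⟨a, ha, rfl⟩ _ ⟨b, hb, rfl⟩ h
      exact congrArg Subtype.val (hU.src_inj ha hb (Subtype.ext h))
    · rintro _ ⟨a, ha, rfl⟩ _ ⟨b, hb, rfl⟩ h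
      exact congrArg Subtype.val (hU.rng_inj ha hb (Subtype.ext h))
    · funext g
      classical
      change (Subtype.val '' U).indicator (fun _ => (1 : K)) g.1 = U.indicator (fun _ => 1) g
      simp only [Set.indicator_apply, Subtype.val_injective.mem_set_image]
  exact this hf

end

/-- Restriction to a subgroupoid is multiplicative on functions that vanish outside of it. -/
theorem convolution_comp_val {G : Type u} [ArrowGroupoid G] {S : Subgroupoid G} {f g : G → K}
    (hf : ∀ a ∉ S.carrier, f a = 0) (hg : ∀ a ∉ S.carrier, g a = 0) (γ : S.carrier) :
    convolution (fun a : S.carrier => f a.1) (fun a : S.carrier => g a.1) γ =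
      convolution f g γ.1 := by
  let e : S.carrier × S.carrier → G × G := Prod.map Subtype.val Subtype.val
  have he : Function.Injective e := Subtype.val_injective.prodMap Subtype.val_injective
  refine (finsum_mem_image (f := fun p : G × G => f p.1 * g p.2) (g := e) he.injOn).symm.trans ?_
  refine finsum_mem_inter_support_eq' _ _ _ fun p hp => ⟨?_, ?_⟩
  · rintro ⟨q, ⟨h, hq⟩, rfl⟩
    exact ⟨congrArg Subtype.val h, congrArg Subtype.val hq⟩
  · rintro ⟨h, hq⟩
    have h1 : p.1 ∈ S.carrier := by
      by_contra hcon
      exact left_ne_zero_of_mul hp (hf _ hcon)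
    have h2 : p.2 ∈ S.carrier := by
      by_contra hcon
      exact right_ne_zero_of_mul hp (hg _ hcon)
    exact ⟨(⟨p.1, h1⟩, ⟨p.2, h2⟩), ⟨Subtype.ext h, Subtype.ext hq⟩, rfl⟩

end ArrowGroupoid

namespace DirectedGraph

variable {V : Type u} {E : Type v} {Γ : DirectedGraph V E} {K : Type w} [Field K]

open ArrowGroupoid TopologicalSpace

/-! ### Surjectivity -/

variable (Γ K) in
/-- The span of the characteristic functions of the cylinders. -/
def cylSpan : Submodule K (Γ.GraphGroupoid → K) :=
  Submodule.span K {f | ∃ v l m, f = (Γ.cyl v l m).indicator 1}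

theorem indicator_cyl_mem (v : V) (l m : List E) :
    (Γ.cyl v l m).indicator 1 ∈ Γ.cylSpan K :=
  Submodule.subset_span ⟨v, l, m, rfl⟩

/-- Since cylinders are nested or disjoint, their span is closed under pointwise products. -/
theorem mul_mem_cylSpan {f g : Γ.GraphGroupoid → K} (hf : f ∈ Γ.cylSpan K)
    (hg : g ∈ Γ.cylSpan K) : f * g ∈ Γ.cylSpan K := by
  induction hf, hg using Submodule.span_induction₂ with
  | mem_mem f g hf hg =>
    obtain ⟨v, l, m, rfl⟩ := hf
    obtain ⟨w, l', m', rfl⟩ := hg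
    rw [← Set.inter_indicator_one]
    by_cases hd : Disjoint (Γ.cyl v l m) (Γ.cyl w l' m')
    · rw [hd.inter_eq, Set.indicator_empty]
      exact Submodule.zero_mem _
    · obtain ⟨γ, h₁, h₂⟩ := Set.not_disjoint_iff.1 hd
      rcases le_total l.length l'.length with hl | hl
      · rw [Set.inter_eq_right.2 (cyl_subset h₁ h₂ hl)]
        exact indicator_cyl_mem _ _ _
      · rw [Set.inter_eq_left.2 (cyl_subset h₂ h₁ hl)]
        exact indicator_cyl_mem _ _ _
  | zero_left g _ => rw [zero_mul]; exact Submodule.zero_mem _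
  | zero_right f _ => rw [mul_zero]; exact Submodule.zero_mem _
  | add_left f f' g _ _ _ h h' => rw [add_mul]; exact Submodule.add_mem _ h h'
  | add_right f g g' _ _ _ h h' => rw [mul_add]; exact Submodule.add_mem _ h h'
  | smul_left k f g _ _ h => rw [smul_mul_assoc]; exact Submodule.smul_mem _ _ h
  | smul_right k f g _ _ h => rw [mul_smul_comm]; exact Submodule.smul_mem _ _ h

theorem indicator_union_mem {A B : Set Γ.GraphGroupoid} (hA : A.indicator 1 ∈ Γ.cylSpan K)
    (hB : B.indicator 1 ∈ Γ.cylSpan K) : (A ∪ B).indicator 1 ∈ Γ.cylSpan K := by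
  have h : (A ∪ B).indicator (1 : Γ.GraphGroupoid → K) =
      A.indicator 1 + B.indicator 1 - A.indicator 1 * B.indicator 1 := by
    classical
    funext g
    by_cases h₁ : g ∈ A <;> by_cases h₂ : g ∈ B <;> simp [h₁, h₂]
  rw [h]
  exact Submodule.sub_mem _ (Submodule.add_mem _ hA hB) (mul_mem_cylSpan hA hB)

theorem indicator_sdiff_mem {A B : Set Γ.GraphGroupoid} (hA : A.indicator 1 ∈ Γ.cylSpan K)
    (hB : B.indicator 1 ∈ Γ.cylSpan K) : (A \ B).indicator 1 ∈ Γ.cylSpan K := by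
  have h : (A \ B).indicator (1 : Γ.GraphGroupoid → K) =
      A.indicator 1 - A.indicator 1 * B.indicator 1 := by
    classical
    funext g
    by_cases h₁ : g ∈ A <;> by_cases h₂ : g ∈ B <;> simp [h₁, h₂]
  rw [h]
  exact Submodule.sub_mem _ hA (mul_mem_cylSpan hA hB)

theorem indicator_biUnion_mem {ι : Type*} {s : Set ι} (hs : s.Finite)
    {A : ι → Set Γ.GraphGroupoid} (hA : ∀ i, (A i).indicator 1 ∈ Γ.cylSpan K) :
    (⋃ i ∈ s, A i).indicator 1 ∈ Γ.cylSpan K := by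
  induction s, hs using Set.Finite.induction_on with
  | empty =>
    rw [Set.biUnion_empty, Set.indicator_empty]
    exact Submodule.zero_mem _
  | insert _ _ ih =>
    rw [Set.biUnion_insert]
    exact indicator_union_mem (hA _) ih

theorem indicator_mem_cylSpan {U : Set Γ.GraphGroupoid} (hUc : IsCompact U) (hU : IsOpen U) :
    U.indicator 1 ∈ Γ.cylSpan K := by
  let b : V × List E × List E × Finset E → Set Γ.GraphGroupoid :=
    fun p => Γ.cylDiff p.1 p.2.1 p.2.2.1 p.2.2.2
  have hb : IsTopologicalBasis (Set.range b) := by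
    convert isTopologicalBasis_cylDiff (Γ := Γ) using 1
    ext S
    simp [b, eq_comm]
  obtain ⟨s, hs, rfl⟩ :=
    eq_finite_iUnion_of_isTopologicalBasis_of_isCompact_open b hb U hUc hU
  refine indicator_biUnion_mem hs fun p => indicator_sdiff_mem (indicator_cyl_mem _ _ _) ?_
  exact indicator_biUnion_mem (s := (p.2.2.2 : Set E)) (Finset.finite_toSet _)
    fun e => indicator_cyl_mem _ _ _

theorem toSteinberg_surjective : Function.Surjective (Γ.toSteinberg K) := by
  have h : steinbergSubmodule K Γ.GraphGroupoid ≤ LinearMap.range ((steinbergVal K _).comp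
      (Γ.toSteinberg K : Γ.LeavittPathAlgebra K →ₗ[K] SteinbergAlgebra K Γ.GraphGroupoid)) := by
    refine Submodule.span_le.2 ?_
    rintro _ ⟨U, hUc, hU, rfl⟩
    refine (Submodule.span_le.2 ?_ : Γ.cylSpan K ≤ _) (indicator_mem_cylSpan hUc hU.isOpen)
    rintro _ ⟨v, l, m, rfl⟩
    exact ⟨Γ.leavittMonomial K v l m, congrArg Subtype.val (toSteinberg_monomial v l m)⟩
  intro f
  obtain ⟨x, hx⟩ := h f.2
  exact ⟨x, Subtype.ext hx⟩

/-! ### Corners of the Leavitt path algebra -/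

variable (Γ K) in
/-- The span of the monomials `α β*` with `s(α), s(β) ∈ H`. -/
noncomputable def cornerSpan (H : Set V) : Submodule K (Γ.LeavittPathAlgebra K) :=
  Submodule.span K {x | ∃ v l m, Γ.listStart v l ∈ H ∧ Γ.listStart v m ∈ H ∧
    x = Γ.leavittMonomial K v l m}

theorem monomial_mem_cornerSpan {H : Set V} {v : V} {l m : List E}
    (h : Γ.listStart v l ∈ H) (h' : Γ.listStart v m ∈ H) :
    Γ.leavittMonomial K v l m ∈ Γ.cornerSpan K H :=
  Submodule.subset_span ⟨v, l, m, h, h', rfl⟩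

theorem mem_cornerLike_iff {H : Set V} {x : Γ.LeavittPathAlgebra K} :
    x ∈ cornerLike K (Γ.leavittVertex K '' H) ↔ x ∈ Γ.cornerSpan K H := by
  constructor
  · intro hx
    refine (Submodule.span_le.2 ?_ : Submodule.span K _ ≤ _) hx
    rintro _ ⟨_, ⟨u, hu, rfl⟩, _, ⟨w, hw, rfl⟩, a, rfl⟩
    refine map_mem_of_monomial ((LinearMap.mulRight K (Γ.leavittVertex K w)).comp
      (LinearMap.mulLeft K (Γ.leavittVertex K u))) (fun v l _ m => ?_) (mem_monomialSpan_univ a)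
    rw [LinearMap.comp_apply, LinearMap.mulLeft_apply, LinearMap.mulRight_apply]
    by_cases h : u = Γ.listStart v l
    · rw [h, listStart_mul_monomial]
      by_cases h' : Γ.listStart v m = w
      · rw [← h', monomial_mul_listStart]
        exact monomial_mem_cornerSpan (h ▸ hu) (h' ▸ hw)
      · rw [monomial_mul_vertex_ne h']
        exact Submodule.zero_mem _
    · rw [vertex_mul_monomial_ne h, zero_mul]
      exact Submodule.zero_mem _
  · intro hx
    refine (Submodule.span_le.2 ?_ : Γ.cornerSpan K H ≤ Submodule.span K _) hx
    rintro _ ⟨v, l, m, h, h', rfl⟩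
    refine Submodule.subset_span ⟨_, ⟨_, h, rfl⟩, _, ⟨_, h', rfl⟩, Γ.leavittMonomial K v l m, ?_⟩
    rw [listStart_mul_monomial, monomial_mul_listStart]

/-- The image of the corner consists of functions supported on the restricted groupoid. -/
theorem toSteinberg_eq_zero_of_notMem {H : Set V} {x : Γ.LeavittPathAlgebra K}
    (hx : x ∈ Γ.cornerSpan K H) {g : Γ.GraphGroupoid} (hg : g ∉ Γ.restrictSet H) :
    (Γ.toSteinberg K x).1 g = 0 := by
  rw [← evalAt_apply, ← LinearMap.mem_ker]
  refine (Submodule.span_le.2 ?_ : Γ.cornerSpan K H ≤ _) hx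
  rintro _ ⟨v, l, m, h, h', rfl⟩
  rw [SetLike.mem_coe, LinearMap.mem_ker, evalAt_monomial, Set.indicator_of_notMem]
  exact fun hg' => hg (cyl_subset_restrictSet h h' hg')

/-- Modulo functions that vanish on the restricted groupoid, every element of the Leavitt path
algebra lies in the corner. -/
theorem exists_mem_cornerSpan (H : Set V) (x : Γ.LeavittPathAlgebra K) :
    ∃ y ∈ Γ.cornerSpan K H, ∀ g ∈ Γ.restrictSet H,
      (Γ.toSteinberg K y).1 g = (Γ.toSteinberg K x).1 g := by
  simp only [← evalAt_apply]
  induction mem_monomialSpan_univ x using Submodule.span_induction with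
  | mem x hx =>
    obtain ⟨v, l, -, m, rfl⟩ := hx
    by_cases h : Γ.listStart v l ∈ H ∧ Γ.listStart v m ∈ H
    · exact ⟨_, monomial_mem_cornerSpan h.1 h.2, fun _ _ => rfl⟩
    · refine ⟨0, Submodule.zero_mem _, fun g hg => ?_⟩
      rw [map_zero, evalAt_monomial, Set.indicator_of_notMem]
      intro hg'
      rw [mem_restrictSet, start_target_of_mem_cyl hg', start_source_of_mem_cyl hg'] at hg
      exact h hg
  | zero => exact ⟨0, Submodule.zero_mem _, fun _ _ => rfl⟩
  | add x y _ _ hx hy =>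
    obtain ⟨a, ha, ha'⟩ := hx
    obtain ⟨b, hb, hb'⟩ := hy
    refine ⟨a + b, Submodule.add_mem _ ha hb, fun g hg => ?_⟩
    rw [map_add, map_add, ha' g hg, hb' g hg]
  | smul k x _ hx =>
    obtain ⟨a, ha, ha'⟩ := hx
    refine ⟨k • a, Submodule.smul_mem _ k ha, fun g hg => ?_⟩
    rw [map_smul, map_smul, ha' g hg]

variable (Γ K) in
/-- The homomorphism from the corner to the Steinberg algebra of the restricted groupoid: the
homomorphism `toSteinberg` followed by restriction of functions. -/
noncomputable def cornerToSteinberg (H : Set V) :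
    cornerLike K (Γ.leavittVertex K '' H) →ₙₐ[K] SteinbergAlgebra K (Γ.restrict H).carrier where
  toFun x := ⟨fun g => (Γ.toSteinberg K x.1).1 g.1,
    comp_val_mem_steinbergSubmodule (isClopen_restrictSet H) isOpenMap_src
      (Γ.toSteinberg K x.1).2⟩
  map_smul' k x := Subtype.ext (funext fun g => (Γ.evalAt K g.1).map_smul k x.1)
  map_zero' := Subtype.ext (funext fun g => (Γ.evalAt K g.1).map_zero)
  map_add' x y := Subtype.ext (funext fun g => (Γ.evalAt K g.1).map_add x.1 y.1)
  map_mul' x y := Subtype.ext (funext fun g =>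
    (congrArg (fun z : SteinbergAlgebra K Γ.GraphGroupoid => z.1 g.1)
      (map_mul (Γ.toSteinberg K) x.1 y.1)).trans
    (convolution_comp_val
      (fun _ ha => toSteinberg_eq_zero_of_notMem (mem_cornerLike_iff.1 x.2) ha)
      (fun _ ha => toSteinberg_eq_zero_of_notMem (mem_cornerLike_iff.1 y.2) ha) g).symm)

theorem cornerToSteinberg_bijective (H : Set V) :
    Function.Bijective (Γ.cornerToSteinberg K H) := by
  constructor
  · intro x y h
    refine Subtype.ext (toSteinberg_injective (Subtype.ext (funext fun g => ?_)))
    by_cases hg : g ∈ Γ.restrictSet H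
    · have h := congrArg Subtype.val h
      exact congrFun h ⟨g, hg⟩
    · rw [toSteinberg_eq_zero_of_notMem (mem_cornerLike_iff.1 x.2) hg,
        toSteinberg_eq_zero_of_notMem (mem_cornerLike_iff.1 y.2) hg]
  · intro f
    obtain ⟨F, hF, hFf⟩ := exists_extension_mem_steinbergSubmodule
      (isClopen_restrictSet H).isOpen isOpenMap_src f.2
    obtain ⟨x, hx⟩ := toSteinberg_surjective (⟨F, hF⟩ : SteinbergAlgebra K Γ.GraphGroupoid)
    obtain ⟨y, hy, hyx⟩ := exists_mem_cornerSpan H x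
    refine ⟨⟨y, mem_cornerLike_iff.2 hy⟩, Subtype.ext (Eq.trans (funext fun g => ?_) hFf)⟩
    exact (hyx g.1 g.2).trans (by rw [hx])

/-- For finite `H`, the sum of the vertices in `H` is an idempotent whose corner is `cornerLike`. -/
theorem algebraCorner_eq_cornerLike {H : Set V} (hfin : H.Finite) :
    algebraCorner K (∑ v ∈ hfin.toFinset, Γ.leavittVertex K v) =
      cornerLike K (Γ.leavittVertex K '' H) := by
  classical
  have hleft : ∀ u ∈ H, (∑ v ∈ hfin.toFinset, Γ.leavittVertex K v) * Γ.leavittVertex K u =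
      Γ.leavittVertex K u := by
    intro u hu
    rw [Finset.sum_mul, Finset.sum_eq_single_of_mem u (hfin.mem_toFinset.2 hu), vertex_mul_self]
    exact fun v _ hv => vertex_mul_ne hv
  have hright : ∀ u ∈ H, Γ.leavittVertex K u * (∑ v ∈ hfin.toFinset, Γ.leavittVertex K v) =
      Γ.leavittVertex K u := by
    intro u hu
    rw [Finset.mul_sum, Finset.sum_eq_single_of_mem u (hfin.mem_toFinset.2 hu), vertex_mul_self]
    exact fun v _ hv => vertex_mul_ne hv.symm
  refine SetLike.ext fun x => ⟨?_, fun hx => ?_⟩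
  · rintro ⟨a, rfl⟩
    rw [Finset.sum_mul, Finset.sum_mul_sum]
    refine sum_mem fun v hv => sum_mem fun w hw => Submodule.subset_span ?_
    exact ⟨_, ⟨v, hfin.mem_toFinset.1 hv, rfl⟩, _, ⟨w, hfin.mem_toFinset.1 hw, rfl⟩, a, rfl⟩
  · refine (Submodule.span_le.2 ?_ : Submodule.span K _ ≤ (algebraCorner K _).toSubmodule) hx
    rintro _ ⟨_, ⟨u, hu, rfl⟩, _, ⟨w, hw, rfl⟩, a, rfl⟩
    refine ⟨Γ.leavittVertex K u * a * Γ.leavittVertex K w, ?_⟩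
    rw [← mul_assoc, ← mul_assoc, hleft u hu, mul_assoc _ (Γ.leavittVertex K w), hright w hw]

end DirectedGraph

theorem theorem2p10 {V E K : Type*} [Field K] (Γ : DirectedGraph V E)
    (H : Set V) (hH : H.Nonempty) :
    IsOpen (Γ.restrict H).carrier ∧
    ∃ _ : ArrowGroupoid.IsAmpleGroupoid (Γ.restrict H).carrier,
      (∃ φ : cornerLike K (Γ.leavittVertex K '' H) →ₙₐ[K]
          ArrowGroupoid.SteinbergAlgebra K (Γ.restrict H).carrier, Function.Bijective φ) ∧
      ∀ hfin : H.Finite,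
        ∃ φ : algebraCorner K (∑ v ∈ hfin.toFinset, Γ.leavittVertex K v) →ₙₐ[K]
          ArrowGroupoid.SteinbergAlgebra K (Γ.restrict H).carrier, Function.Bijective φ := by
  refine ⟨(DirectedGraph.isClopen_restrictSet H).isOpen, inferInstance,
    ⟨Γ.cornerToSteinberg K H, DirectedGraph.cornerToSteinberg_bijective H⟩, fun hfin => ?_⟩
  rw [DirectedGraph.algebraCorner_eq_cornerLike hfin]
  exact ⟨Γ.cornerToSteinberg K H, DirectedGraph.cornerToSteinberg_bijective H⟩
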